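/- For $b>0$ and $1\le p\le\infty$ let $PW_b^p$ be the space of $f\in L^p(\mathbb R)$ whose Fourier transform $\hat f(\xi)=\int f(x)e^{-2\pi i x\xi}\,dx$, in the sense of tempered distributions, is supported in $[-\tfrac b2,\tfrac b2]$ (each such $f$ is identified with its continuous representative), and let $PW_b^+$ be the space of entire functions $f$ with $$\limsup_{r\to\infty}\int_{|z|=r}\left|z^{-2}e^{-\pi b|\mathrm{Im}(z)|}f(z)\right||dz|<\infty .$$ Let $\psi=\Gamma'/\Gamma$ be the digamma function, and let $G_1(z)=\sin(\pi z)\psi(-z)$, where the removable singularities at $z=0,1,2,\dots$ are filled in by their limits. Put $a_k=0$ for integers $k<0$ and $a_k=(-1)^k\pi$ for integers $k\ge0$. Then: 1. $G_1\in PW_1^+$, while the restriction of $G_1$ to $\mathbb R$ is not in $PW_1^\infty$. 2. $G_1(k)=a_k$ for all $k\in\mathbb Z$. 3. Let $S(z)=\sin(\pi z)/\pi$. For every $\tilde x\in\mathbb R\setminus\mathbb Z$ and $\tilde a\in\mathbb C$ the bandlimited interpolation $$f(z)=\tilde a\frac{S(z)}{S(\tilde x)}+\sum_{k=-\infty}^{\infty}a_k\lim_{z_0\to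 z}\frac{S(z_0)}{S'(k)}\left(\frac1{z_0-k}-\frac1{\tilde x-k}\right)$$ converges uniformly on compact subsets of $\mathbb C$ and is of the form $f(z)=G_1(z)+c\sin(\pi z)$ for a constant $c\in\mathbb C$. 4. There is no $f\in PW_1^\infty$ with $f(k)=a_k$ for all $k\in\mathbb Z$. 5. There are constants $C>0$ and $r_0$ such that $\frac1r\int_{-r}^{0}|G_1(t)|\,dt\ge C\log r$ for all $r\ge r_0$; in particular $\sup_{r>0}\frac1{2r}\int_{-r}^{r}|G_1(t)|\,dt=\infty$. -/

import Mathlib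

open MeasureTheory Filter Topology
open scoped ENNReal FourierTransform SchwartzMap

noncomputable section

/-- The Paley–Wiener space `PW_b^p`: the classes `f ∈ L^p(ℝ)` whose Fourier transform
`∫ f(x) e^{-2πixξ} dx`, taken in the sense of tempered distributions, is supported
in `[-b/2, b/2]`. -/
def PaleyWiener (b : ℝ) (p : ℝ≥0∞) [Fact (1 ≤ p)] : Set (Lp ℂ p (volume : Measure ℝ)) :=
  {f | Distribution.dsupport (𝓕 (Lp.toTemperedDistribution f : 𝓢'(ℝ, ℂ)) : 𝓢'(ℝ, ℂ)) ⊆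
    Set.Icc (-(b / 2)) (b / 2)}

/-- The space `PW_b^+`: the entire functions `f` with
`limsup_{r → ∞} ∫_{|z| = r} |z⁻² e^{-πb|Im z|} f(z)| |dz| < ∞`. The circle is parametrized by
`z = r e^{iθ}`, `0 < θ ≤ 2π`, and `|dz| = r dθ`. -/
def PaleyWienerPlus (b : ℝ) : Set (ℂ → ℂ) :=
  {f | Differentiable ℂ f ∧
    limsup (fun r : ℝ => ∫⁻ θ in Set.Ioc 0 (2 * Real.pi),
      ‖(circleMap 0 r θ) ^ (-2 : ℤ) *
        (Real.exp (-(Real.pi * b * |(circleMap 0 r θ).im|)) : ℂ) *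
          f (circleMap 0 r θ)‖ₑ * ENNReal.ofReal r) atTop < ⊤}

/-- `G₁(z) = sin(πz) ψ(-z)`, the removable singularities at the poles of `ψ(-z)`
being filled in by limits. -/
def G₁ (z : ℂ) : ℂ :=
  limUnder (𝓝[≠] z) fun w : ℂ => Complex.sin (Real.pi * w) * Complex.digamma (-w)

/-- The samples `a_k = 0` for `k < 0` and `a_k = (-1)^k π` for `k ≥ 0`. -/
def stepSamples (k : ℤ) : ℂ := if k < 0 then 0 else (-1) ^ k * (Real.pi : ℂ)

/-- The generating function `S(z) = sin(πz)/π` of the sequence of the integers. -/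
def intGenFun (z : ℂ) : ℂ := Complex.sin (Real.pi * z) / Real.pi

/-- The function `z ↦ lim_{z₀ → z} S(z₀)/S'(k) · (1/(z₀ - k) - 1/(x - k))`. -/
def interpKernel (x : ℝ) (k : ℤ) (z : ℂ) : ℂ :=
  limUnder (𝓝[≠] z) fun w : ℂ =>
    intGenFun w / deriv intGenFun (k : ℂ) * (1 / (w - k) - 1 / ((x : ℂ) - k))

/-- `f` is the bandlimited interpolation of the data `a` on `ℤ` and `a'` at the extra point `x`:
`f(z) = a' S(z)/S(x) + ∑_k a_k lim_{z₀ → z} S(z₀)/S'(k) (1/(z₀ - k) - 1/(x - k))`,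
with uniform convergence on compact subsets of `ℂ`. -/
def IsBandlimitedInterp (a : ℤ → ℂ) (x : ℝ) (a' : ℂ) (f : ℂ → ℂ) : Prop :=
  HasSumLocallyUniformly (fun (k : ℤ) (z : ℂ) => a k * interpKernel x k z)
    (fun z => f z - a' * (intGenFun z / intGenFun x))

end

/-!
The step samples are bounded, so their cardinal series, normalized to vanish at a base point off
`ℤ`, converges locally uniformly and grows at most like `(1 + |z|) e^{π|Im z|}`; changing the base
point adds a multiple of `sin(πz)`. On the negative half-line its partial sums telescope by the
recurrence of the digamma function, which identifies it with `G₁` up to a multiple of `sin(πz)`.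
Since `ψ(s) ≥ log s - 1/s`, the averages of `|G₁|` over `[-r, 0]` grow logarithmically.

Suppose that `g ∈ PW_1^∞` has the step samples. Then `w(x) = g(x + 1) + g(x)` vanishes at every
integer except `-1`, where it equals `π`. A bounded function of spectrum `[-1/2, 1/2]` is determined
by its integer samples only up to the edge frequencies `±1/2`, which the operator `g(· + 1) + g`
annihilates, so `w(x) = π sinc(π(x + 1))`. The recurrence of `ψ` gives
`G₁(x + 1) + G₁(x)` the same value. Hence `g - G₁` changes sign under the shift by `1`, so
it is bounded on `ℝ`, and `G₁` would be bounded on `ℝ` as well.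
-/

noncomputable section

/-! ### The generating function of the integers -/

lemma norm_sin_le_exp_abs_im (z : ℂ) : ‖Complex.sin z‖ ≤ Real.exp |z.im| := by
  have h1 : ‖Complex.exp (-z * Complex.I)‖ ≤ Real.exp |z.im| := by
    rw [Complex.norm_exp]
    exact Real.exp_le_exp.2 (by simpa using le_abs_self z.im)
  have h2 : ‖Complex.exp (z * Complex.I)‖ ≤ Real.exp |z.im| := by
    rw [Complex.norm_exp]
    exact Real.exp_le_exp.2 (by simpa using neg_le_abs z.im)
  rw [Complex.sin, norm_div, norm_mul, Complex.norm_I, Complex.norm_ofNat]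
  linarith [norm_sub_le (Complex.exp (-z * Complex.I)) (Complex.exp (z * Complex.I))]

lemma norm_cos_le_exp_abs_im (z : ℂ) : ‖Complex.cos z‖ ≤ Real.exp |z.im| := by
  rw [← Complex.sin_add_pi_div_two]
  simpa using norm_sin_le_exp_abs_im (z + (Real.pi / 2 : ℝ))

lemma abs_im_pi_mul (z : ℂ) : |(Real.pi * z : ℂ).im| = Real.pi * |z.im| := by
  rw [Complex.im_ofReal_mul, abs_mul, abs_of_pos Real.pi_pos]

lemma norm_intGenFun_le (z : ℂ) : ‖intGenFun z‖ ≤ Real.exp (Real.pi * |z.im|) := by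
  rw [intGenFun, norm_div, Complex.norm_real, Real.norm_of_nonneg Real.pi_pos.le, ← abs_im_pi_mul]
  exact (div_le_self (norm_nonneg _) (by linarith [Real.pi_gt_three])).trans
    (norm_sin_le_exp_abs_im _)

lemma hasDerivAt_intGenFun (z : ℂ) : HasDerivAt intGenFun (Complex.cos (Real.pi * z)) z := by
  have hπ : (Real.pi : ℂ) ≠ 0 := Complex.ofReal_ne_zero.2 Real.pi_ne_zero
  have h : HasDerivAt intGenFun (Complex.cos (Real.pi * z) * (Real.pi * 1) / Real.pi) z :=
    ((hasDerivAt_id z).const_mul (Real.pi : ℂ)).csin.div_const _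
  rwa [mul_one, mul_div_cancel_right₀ _ hπ] at h

lemma differentiable_intGenFun : Differentiable ℂ intGenFun :=
  fun z => (hasDerivAt_intGenFun z).differentiableAt

lemma intGenFun_intCast (k : ℤ) : intGenFun k = 0 := by
  rw [intGenFun, mul_comm, Complex.sin_int_mul_pi, zero_div]

lemma deriv_intGenFun_intCast (k : ℤ) : deriv intGenFun k = (-1) ^ k := by
  rw [(hasDerivAt_intGenFun k).deriv, mul_comm]
  rw_mod_cast [Real.cos_int_mul_pi k]
  simp

lemma intGenFun_ne_zero {z : ℂ} (hz : ∀ k : ℤ, z ≠ k) : intGenFun z ≠ 0 := by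
  have hπ : (Real.pi : ℂ) ≠ 0 := Complex.ofReal_ne_zero.2 Real.pi_ne_zero
  intro h
  obtain ⟨k, hk⟩ := Complex.sin_eq_zero_iff.1 ((div_eq_zero_iff.1 h).resolve_right hπ)
  exact hz k (mul_left_cancel₀ hπ (hk.trans (mul_comm _ _)))

lemma norm_dslope_le {f : ℂ → ℂ} (hf : Differentiable ℂ f) {s : Set ℂ} (hs : Convex ℝ s) {C : ℝ}
    (hC : ∀ z ∈ s, ‖deriv f z‖ ≤ C) {a b : ℂ} (ha : a ∈ s) (hb : b ∈ s) : ‖dslope f a b‖ ≤ C := by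
  rcases eq_or_ne b a with rfl | hne
  · rw [dslope_same]
    exact hC b hb
  · rw [dslope_of_ne _ hne, slope_def_field, norm_div,
      div_le_iff₀ (norm_pos_iff.2 (sub_ne_zero.2 hne))]
    exact hs.norm_image_sub_le_of_norm_deriv_le (fun z _ => hf z) hC ha hb

lemma norm_dslope_intGenFun_mul_le (k : ℤ) (z : ℂ) :
    ‖dslope intGenFun k z‖ * (1 + ‖z - k‖) ≤ 2 * Real.exp (Real.pi * |z.im|) := by
  have hslope : ‖dslope intGenFun k z‖ ≤ Real.exp (Real.pi * |z.im|) := by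
    refine norm_dslope_le differentiable_intGenFun
      ((convex_halfSpace_im_ge (-|z.im|)).inter (convex_halfSpace_im_le |z.im|)) (fun w hw => ?_)
      (by simp) ⟨neg_abs_le z.im, le_abs_self z.im⟩
    rw [(hasDerivAt_intGenFun w).deriv]
    refine (norm_cos_le_exp_abs_im _).trans (Real.exp_le_exp.2 ?_)
    rw [abs_im_pi_mul]
    exact mul_le_mul_of_nonneg_left (abs_le.2 hw) Real.pi_pos.le
  have hmul : ‖z - k‖ * ‖dslope intGenFun k z‖ ≤ Real.exp (Real.pi * |z.im|) := by
    rw [← norm_smul, sub_smul_dslope, intGenFun_intCast, sub_zero]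
    exact norm_intGenFun_le z
  linarith

/-! ### The cardinal series of bounded data -/

/-- The entire function `S(z)/S'(k) · (1/(z - k) - 1/(w - k))` of `z`, where `w ∉ ℤ` is a complex
base point. The factor `S(z)/(z - k)` is encoded by `dslope`, and the difference of the two
fractions is combined into the single one `(w - z)/((z - k)(w - k))`. -/
def cardinalTerm (w : ℂ) (k : ℤ) (z : ℂ) : ℂ :=
  (-1) ^ k * dslope intGenFun k z * (w - z) / (w - k)

/-- The cardinal series of the data `a` on the integers, normalized to vanish at the base point
`w ∉ ℤ`, which makes it converge for bounded data. -/
def cardinalSeries (a : ℤ → ℂ) (w z : ℂ) : ℂ := ∑' k, a k * cardinalTerm w k z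

lemma cardinalTerm_of_ne {w z : ℂ} {k : ℤ} (hw : w ≠ k) (hz : z ≠ k) :
    cardinalTerm w k z = (-1) ^ k * intGenFun z * (1 / (z - k) - 1 / (w - k)) := by
  have hw' := sub_ne_zero.2 hw
  have hz' := sub_ne_zero.2 hz
  rw [cardinalTerm, dslope_of_ne _ hz, slope_def_field, intGenFun_intCast]
  field_simp
  ring

lemma cardinalTerm_intCast_self {w : ℂ} {k : ℤ} (hw : w ≠ k) : cardinalTerm w k k = 1 := by
  rw [cardinalTerm, dslope_same, deriv_intGenFun_intCast, mul_div_assoc,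
    div_self (sub_ne_zero.2 hw), mul_one, ← mul_zpow, neg_one_mul, neg_neg, one_zpow]

lemma cardinalTerm_intCast_of_ne (w : ℂ) {j k : ℤ} (h : j ≠ k) : cardinalTerm w k j = 0 := by
  rw [cardinalTerm, dslope_of_ne _ (Int.cast_injective.ne h), slope_def_field, intGenFun_intCast,
    intGenFun_intCast, sub_zero, zero_div, mul_zero, zero_mul, zero_div]

lemma differentiable_cardinalTerm (w : ℂ) (k : ℤ) : Differentiable ℂ (cardinalTerm w k) := by
  have h : Differentiable ℂ (dslope intGenFun k) := by
    rw [← differentiableOn_univ, Complex.differentiableOn_dslope univ_mem]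
    exact differentiable_intGenFun.differentiableOn
  unfold cardinalTerm
  fun_prop

lemma interpKernel_eq_cardinalTerm {x : ℝ} {k : ℤ} (hx : x ≠ k) (z : ℂ) :
    interpKernel x k z = cardinalTerm x k z := by
  refine Tendsto.limUnder_eq ((((differentiable_cardinalTerm x k).continuous.tendsto z).mono_left
    nhdsWithin_le_nhds).congr' ?_)
  have hne : ∀ᶠ w in 𝓝[≠] z, w ≠ (k : ℂ) := by
    rcases eq_or_ne z k with rfl | h
    · exact self_mem_nhdsWithin
    · exact mem_nhdsWithin_of_mem_nhds (isOpen_ne.mem_nhds h)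
  filter_upwards [hne] with w hw
  rw [cardinalTerm_of_ne (by exact_mod_cast hx) hw, deriv_intGenFun_intCast,
    div_eq_mul_inv (intGenFun w), ← inv_zpow, inv_neg_one, mul_comm (intGenFun w)]

lemma exists_mul_one_add_abs_le_norm_sub_intCast {w : ℂ} (hw : ∀ k : ℤ, w ≠ k) :
    ∃ c : ℝ, 0 < c ∧ ∀ k : ℤ, c * (1 + |(k : ℝ)|) ≤ ‖w - k‖ := by
  have hclosed : IsClosed (Set.range ((↑) : ℤ → ℂ)) :=
    Complex.isClosedEmbedding_intCast.isClosed_range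
  set d := Metric.infDist w (Set.range ((↑) : ℤ → ℂ))
  have hd : 0 < d := (hclosed.notMem_iff_infDist_pos (Set.range_nonempty _)).1
    fun ⟨k, hk⟩ => hw k hk.symm
  refine ⟨d / (1 + ‖w‖ + d), by positivity, fun k => ?_⟩
  have hdk : d ≤ ‖w - k‖ := by
    rw [← dist_eq_norm]
    exact Metric.infDist_le_dist_of_mem ⟨k, rfl⟩
  have hk : |(k : ℝ)| ≤ ‖w‖ + ‖w - k‖ := by
    rw [← Complex.norm_intCast]
    exact norm_le_norm_add_norm_sub w k
  rw [div_mul_eq_mul_div, div_le_iff₀ (by positivity)]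
  nlinarith [norm_nonneg w]

lemma exists_norm_cardinalTerm_le {w : ℂ} (hw : ∀ k : ℤ, w ≠ k) :
    ∃ B : ℝ, 0 ≤ B ∧ ∀ (k : ℤ) (z : ℂ), ‖cardinalTerm w k z‖ ≤
      B * ((1 + ‖z‖) * Real.exp (Real.pi * |z.im|)) * (1 / ((1 + ‖z - k‖) * (1 + |(k : ℝ)|))) := by
  obtain ⟨c, hc, hck⟩ := exists_mul_one_add_abs_le_norm_sub_intCast hw
  refine ⟨2 * (1 + ‖w‖) / c, by positivity, fun k z => ?_⟩
  have hnum : ‖w - z‖ ≤ (1 + ‖w‖) * (1 + ‖z‖) :=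
    (norm_sub_le w z).trans (by nlinarith [norm_nonneg w, norm_nonneg z])
  have hslope : ‖dslope intGenFun k z‖ ≤ 2 * Real.exp (Real.pi * |z.im|) / (1 + ‖z - k‖) :=
    (le_div_iff₀ (by positivity)).2 (norm_dslope_intGenFun_mul_le k z)
  have : 0 < c * (1 + |(k : ℝ)|) := by positivity
  calc ‖cardinalTerm w k z‖ = ‖dslope intGenFun k z‖ * ‖w - z‖ / ‖w - k‖ := by
        simp [cardinalTerm]
    _ ≤ 2 * Real.exp (Real.pi * |z.im|) / (1 + ‖z - k‖) * ((1 + ‖w‖) * (1 + ‖z‖)) /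
          (c * (1 + |(k : ℝ)|)) := by
        gcongr
        exact hck k
    _ = _ := by field_simp

lemma summable_one_div_one_add_abs_sq : Summable fun k : ℤ => 1 / (1 + |(k : ℝ)|) ^ 2 := by
  refine .of_nat_of_neg ?_ ?_
  all_goals
    refine ((summable_nat_add_iff 1).2 (Real.summable_one_div_nat_pow.2 one_lt_two)).congr ?_
    intro n
    simp [add_comm]

lemma hasSumLocallyUniformly_of_norm_le {ι : Type*} {f : ι → ℂ → ℂ}
    (h : ∀ R : ℝ, ∃ u : ι → ℝ, Summable u ∧ ∀ i, ∀ z : ℂ, ‖z‖ ≤ R → ‖f i z‖ ≤ u i) :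
    HasSumLocallyUniformly f fun z => ∑' i, f i z := by
  rw [hasSumLocallyUniformly_iff_tendstoLocallyUniformly]
  intro v hv z
  obtain ⟨u, hu, hb⟩ := h (‖z‖ + 1)
  refine ⟨Metric.closedBall 0 (‖z‖ + 1), ?_, tendstoUniformlyOn_tsum hu (fun i y hy =>
    hb i y (mem_closedBall_zero_iff.1 hy)) v hv⟩
  refine mem_of_superset (Metric.closedBall_mem_nhds z one_pos) fun y hy => ?_
  rw [mem_closedBall_zero_iff]
  rw [mem_closedBall_iff_norm] at hy
  linarith [norm_le_norm_add_norm_sub' y z]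

lemma one_div_mul_le_add_one_div_sq {s t u : ℝ} (hs : 0 < s) (ht : 0 < t) (hu : s ≤ 2 * u) :
    1 / (u * t) ≤ 1 / s ^ 2 + 1 / t ^ 2 :=
  calc 1 / (u * t) ≤ 1 / (s / 2 * t) := by gcongr; linarith
    _ = 2 * (1 / s) * (1 / t) := by field_simp
    _ ≤ (1 / s) ^ 2 + (1 / t) ^ 2 := two_mul_le_add_sq _ _
    _ = 1 / s ^ 2 + 1 / t ^ 2 := by simp only [one_div, inv_pow]

section CardinalSeries

variable {a : ℤ → ℂ} {A : ℝ} {w : ℂ}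

lemma hasSumLocallyUniformly_cardinalSeries (ha : ∀ k, ‖a k‖ ≤ A) (hw : ∀ k : ℤ, w ≠ k) :
    HasSumLocallyUniformly (fun k z => a k * cardinalTerm w k z) (cardinalSeries a w) := by
  obtain ⟨B, hB, hterm⟩ := exists_norm_cardinalTerm_le hw
  have hA : 0 ≤ A := (norm_nonneg _).trans (ha 0)
  refine hasSumLocallyUniformly_of_norm_le fun R => ⟨fun k => A * (B * ((1 + R) *
    Real.exp (Real.pi * R))) * (1 + R) * (1 / (1 + |(k : ℝ)|) ^ 2),
    summable_one_div_one_add_abs_sq.mul_left _, fun k z hz => ?_⟩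
  have hR : 0 ≤ R := (norm_nonneg z).trans hz
  have hdist : 1 + |(k : ℝ)| ≤ (1 + R) * (1 + ‖z - k‖) := by
    have h := norm_le_norm_add_norm_sub z (k : ℂ)
    rw [Complex.norm_intCast] at h
    nlinarith [norm_nonneg (z - k)]
  have hinv : 1 / ((1 + ‖z - k‖) * (1 + |(k : ℝ)|)) ≤ (1 + R) * (1 / (1 + |(k : ℝ)|) ^ 2) := by
    rw [mul_one_div, div_le_div_iff₀ (by positivity) (by positivity)]
    nlinarith [mul_le_mul_of_nonneg_right hdist (by positivity : 0 ≤ 1 + |(k : ℝ)|)]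
  calc ‖a k * cardinalTerm w k z‖ ≤ A * (B * ((1 + ‖z‖) * Real.exp (Real.pi * |z.im|)) *
          (1 / ((1 + ‖z - k‖) * (1 + |(k : ℝ)|)))) := by
        rw [norm_mul]
        exact mul_le_mul (ha k) (hterm k z) (norm_nonneg _) hA
    _ ≤ A * (B * ((1 + R) * Real.exp (Real.pi * R)) * ((1 + R) * (1 / (1 + |(k : ℝ)|) ^ 2))) := by
        gcongr
        exact (Complex.abs_im_le_norm z).trans hz
    _ = _ := by ring

lemma summable_cardinalSeries (ha : ∀ k, ‖a k‖ ≤ A) (hw : ∀ k : ℤ, w ≠ k) (z : ℂ) :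
    Summable fun k => a k * cardinalTerm w k z :=
  ((hasSumLocallyUniformly_cardinalSeries ha hw).hasSum).summable

lemma differentiable_cardinalSeries (ha : ∀ k, ‖a k‖ ≤ A) (hw : ∀ k : ℤ, w ≠ k) :
    Differentiable ℂ (cardinalSeries a w) := by
  have h := hasSumLocallyUniformly_iff_tendstoLocallyUniformly.1
    (hasSumLocallyUniformly_cardinalSeries ha hw)
  rw [← differentiableOn_univ]
  refine (tendstoLocallyUniformlyOn_univ.2 h).differentiableOn (Eventually.of_forall fun s => ?_)
    isOpen_univ
  exact (Differentiable.fun_sum fun k _ =>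
    (differentiable_cardinalTerm w k).const_mul (a k)).differentiableOn

lemma cardinalSeries_intCast (a : ℤ → ℂ) {k : ℤ} (hw : w ≠ k) : cardinalSeries a w k = a k := by
  rw [cardinalSeries, tsum_eq_single k fun j hj => by
    rw [cardinalTerm_intCast_of_ne w hj.symm, mul_zero], cardinalTerm_intCast_self hw, mul_one]

lemma exists_norm_cardinalSeries_le (ha : ∀ k, ‖a k‖ ≤ A) (hw : ∀ k : ℤ, w ≠ k) :
    ∃ B : ℝ, ∀ z, ‖cardinalSeries a w z‖ ≤ B * ((1 + ‖z‖) * Real.exp (Real.pi * |z.im|)) := by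
  obtain ⟨B, hB, hterm⟩ := exists_norm_cardinalTerm_le hw
  have hA : 0 ≤ A := (norm_nonneg _).trans (ha 0)
  set Z := ∑' k : ℤ, 1 / (1 + |(k : ℝ)|) ^ 2
  refine ⟨A * B * (2 * Z), fun z => ?_⟩
  set D := (1 + ‖z‖) * Real.exp (Real.pi * |z.im|)
  set n := round z.re
  have hshift := (Equiv.subRight n).hasSum_iff.2 summable_one_div_one_add_abs_sq.hasSum
  simp only [Function.comp_def, Equiv.subRight_apply] at hshift
  have hsum := ((hshift.add summable_one_div_one_add_abs_sq.hasSum).mul_left (A * (B * D)))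
  refine (tsum_of_norm_bounded hsum fun k => ?_).trans_eq (by ring)
  have hdist : 1 + |((k - n : ℤ) : ℝ)| ≤ 2 * (1 + ‖z - k‖) := by
    have h1 := Complex.abs_re_le_norm (z - k)
    have h2 := abs_sub_round z.re
    have h3 := abs_sub_le (k : ℝ) z.re n
    rw [Complex.sub_re, Complex.intCast_re, abs_sub_comm] at h1
    push_cast
    linarith [norm_nonneg (z - k)]
  have hinv : 1 / ((1 + ‖z - k‖) * (1 + |(k : ℝ)|)) ≤
      1 / (1 + |((k - n : ℤ) : ℝ)|) ^ 2 + 1 / (1 + |(k : ℝ)|) ^ 2 :=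
    one_div_mul_le_add_one_div_sq (by positivity) (by positivity) hdist
  calc ‖a k * cardinalTerm w k z‖ ≤ A * (B * D * (1 / ((1 + ‖z - k‖) * (1 + |(k : ℝ)|)))) := by
        rw [norm_mul]
        exact mul_le_mul (ha k) (hterm k z) (norm_nonneg _) hA
    _ ≤ A * (B * D * (1 / (1 + |((k - n : ℤ) : ℝ)|) ^ 2 + 1 / (1 + |(k : ℝ)|) ^ 2)) := by gcongr
    _ = _ := by ring

lemma cardinalTerm_change_base {w w' : ℂ} {k : ℤ} (hw : w ≠ k) (hw' : w' ≠ k)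
    (hS : intGenFun w ≠ 0) (z : ℂ) :
    cardinalTerm w k z =
      cardinalTerm w' k z - intGenFun z / intGenFun w * cardinalTerm w' k w := by
  rcases eq_or_ne z k with rfl | hz
  · rw [cardinalTerm_intCast_self hw, cardinalTerm_intCast_self hw', intGenFun_intCast, zero_div,
      zero_mul, sub_zero]
  · rw [cardinalTerm_of_ne hw hz, cardinalTerm_of_ne hw' hz, cardinalTerm_of_ne hw' hw]
    field_simp
    ring

lemma cardinalSeries_change_base (ha : ∀ k, ‖a k‖ ≤ A) (hw : ∀ k : ℤ, w ≠ k) {w' : ℂ}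
    (hw' : ∀ k : ℤ, w' ≠ k) (z : ℂ) :
    cardinalSeries a w z =
      cardinalSeries a w' z - intGenFun z / intGenFun w * cardinalSeries a w' w := by
  unfold cardinalSeries
  rw [← tsum_mul_left, ← (summable_cardinalSeries ha hw' z).tsum_sub
    ((summable_cardinalSeries ha hw' w).mul_left _)]
  refine tsum_congr fun k => ?_
  rw [cardinalTerm_change_base (hw k) (hw' k) (intGenFun_ne_zero hw)]
  ring

lemma isBandlimitedInterp_cardinalSeries (ha : ∀ k, ‖a k‖ ≤ A) {x : ℝ} (hx : ∀ k : ℤ, x ≠ k)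
    (a' : ℂ) : IsBandlimitedInterp a x a'
      fun z => cardinalSeries a x z + a' * (intGenFun z / intGenFun x) := by
  unfold IsBandlimitedInterp
  simp only [add_sub_cancel_right, interpKernel_eq_cardinalTerm (hx _)]
  exact hasSumLocallyUniformly_cardinalSeries ha fun k => by exact_mod_cast hx k

end CardinalSeries

lemma mem_paleyWienerPlus_of_norm_le {b B : ℝ} {f : ℂ → ℂ} (hf : Differentiable ℂ f)
    (hB : ∀ z, ‖f z‖ ≤ B * ((1 + ‖z‖) * Real.exp (Real.pi * b * |z.im|))) :
    f ∈ PaleyWienerPlus b := by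
  have hB0 : 0 ≤ B := by simpa using (norm_nonneg _).trans (hB 0)
  have hpt : ∀ r : ℝ, 1 ≤ r → ∀ θ : ℝ, ‖(circleMap 0 r θ) ^ (-2 : ℤ) *
      (Real.exp (-(Real.pi * b * |(circleMap 0 r θ).im|)) : ℂ) * f (circleMap 0 r θ)‖ₑ *
        ENNReal.ofReal r ≤ ENNReal.ofReal (2 * B) := by
    intro r hr θ
    have hr0 : 0 < r := one_pos.trans_le hr
    set z := circleMap 0 r θ
    set e := Real.exp (Real.pi * b * |z.im|)
    have hz : ‖z‖ = r := by simp [z, abs_of_pos hr0]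
    have he : 0 < e := Real.exp_pos _
    rw [← ofReal_norm, ← ENNReal.ofReal_mul (norm_nonneg _), norm_mul, norm_mul, norm_zpow, hz,
      Complex.norm_real, Real.norm_of_nonneg (Real.exp_pos _).le, Real.exp_neg]
    refine ENNReal.ofReal_le_ofReal ?_
    calc r ^ (-2 : ℤ) * e⁻¹ * ‖f z‖ * r ≤ r ^ (-2 : ℤ) * e⁻¹ * (B * ((1 + r) * e)) * r := by
          gcongr
          exact hz ▸ hB z
      _ = B * (1 + r) / r := by
          rw [zpow_neg]
          field_simp
      _ ≤ 2 * B := by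
          rw [div_le_iff₀ hr0]
          nlinarith
  refine ⟨hf, (limsup_le_of_le (a := ENNReal.ofReal (2 * B) * ENNReal.ofReal (2 * Real.pi))
    (by isBoundedDefault) ?_).trans_lt (ENNReal.mul_lt_top ENNReal.ofReal_lt_top
      ENNReal.ofReal_lt_top)⟩
  filter_upwards [eventually_ge_atTop 1] with r hr
  exact (lintegral_mono (hpt r hr)).trans_eq (by simp)

/-! ### The digamma function -/

lemma differentiableAt_Gamma_of_pos {x : ℝ} (hx : 0 < x) : DifferentiableAt ℝ Real.Gamma x :=
  Real.differentiableAt_Gamma fun m => ne_of_gt (by linarith [m.cast_nonneg (α := ℝ)])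

lemma ofReal_ne_neg_natCast {x : ℝ} (hx : 0 < x) (m : ℕ) : (x : ℂ) ≠ -m := by
  rw [← Complex.ofReal_natCast, ← Complex.ofReal_neg, Ne, Complex.ofReal_inj]
  exact ne_of_gt (by linarith [m.cast_nonneg (α := ℝ)])

lemma digamma_ofReal {x : ℝ} (hx : 0 < x) : Complex.digamma x = (logDeriv Real.Gamma x : ℝ) := by
  have h := (Complex.differentiableAt_Gamma _ (ofReal_ne_neg_natCast hx)).hasDerivAt.comp_ofReal
  simp_rw [Complex.Gamma_ofReal] at h
  rw [Complex.digamma_def, logDeriv_apply, logDeriv_apply, Complex.Gamma_ofReal,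
    h.unique (differentiableAt_Gamma_of_pos hx).hasDerivAt.ofReal_comp, Complex.ofReal_div]

lemma logDeriv_Gamma_add_one {x : ℝ} (hx : 0 < x) :
    logDeriv Real.Gamma (x + 1) = logDeriv Real.Gamma x + 1 / x := by
  have h := Complex.digamma_apply_add_one x (ofReal_ne_neg_natCast hx)
  rw [← Complex.ofReal_one, ← Complex.ofReal_add, digamma_ofReal hx,
    digamma_ofReal (by positivity)] at h
  rw [one_div]
  exact_mod_cast h

lemma log_sub_one_div_le_logDeriv_Gamma_le_log {x : ℝ} (hx : 0 < x) :
    Real.log x - 1 / x ≤ logDeriv Real.Gamma x ∧ logDeriv Real.Gamma x ≤ Real.log x := by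
  have hderiv : ∀ {y : ℝ}, 0 < y →
      HasDerivAt (Real.log ∘ Real.Gamma) (logDeriv Real.Gamma y) y := fun {y} hy =>
    (differentiableAt_Gamma_of_pos hy).hasDerivAt.log (Real.Gamma_pos_of_pos hy).ne'
  have hx1 : 0 < x + 1 := by positivity
  have hslope : slope (Real.log ∘ Real.Gamma) x (x + 1) = Real.log x := by
    rw [slope_def_field, Function.comp_apply, Function.comp_apply, Real.Gamma_add_one hx.ne',
      Real.log_mul hx.ne' (Real.Gamma_pos_of_pos hx).ne']
    ring
  have hlow := Real.convexOn_log_Gamma.slope_le_of_hasDerivAt hx hx1 (lt_add_one x) (hderiv hx1)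
  have hupp := Real.convexOn_log_Gamma.le_slope_of_hasDerivAt hx hx1 (lt_add_one x) (hderiv hx)
  rw [hslope] at hlow hupp
  rw [logDeriv_Gamma_add_one hx] at hlow
  exact ⟨by linarith, hupp⟩

lemma logDeriv_Gamma_add_nat {x : ℝ} (hx : 0 < x) (n : ℕ) :
    logDeriv Real.Gamma (x + n) =
      logDeriv Real.Gamma x + ∑ k ∈ Finset.range n, 1 / (x + k) := by
  induction n with
  | zero => simp
  | succ n ih =>
    rw [Nat.cast_succ, ← add_assoc, logDeriv_Gamma_add_one (by positivity), ih,
      Finset.sum_range_succ, add_assoc]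

lemma tendsto_logDeriv_Gamma_add_nat_sub_log {x : ℝ} (hx : 0 < x) :
    Tendsto (fun n : ℕ => logDeriv Real.Gamma (x + n) - Real.log n) atTop (𝓝 0) := by
  have hlog : Tendsto (fun n : ℕ => Real.log (x + n) - Real.log n) atTop (𝓝 0) := by
    simpa only [add_comm, Function.comp_def] using
      (Real.tendsto_log_comp_add_sub_log x).comp tendsto_natCast_atTop_atTop
  have hinv : Tendsto (fun n : ℕ => 1 / (x + n)) atTop (𝓝 0) := by
    simp only [one_div]
    exact (tendsto_atTop_add_const_left _ x tendsto_natCast_atTop_atTop).inv_tendsto_atTop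
  have hlow := hlog.sub hinv
  rw [sub_zero] at hlow
  refine tendsto_of_tendsto_of_tendsto_of_le_of_le hlow hlog (fun n => ?_) (fun n => ?_)
  all_goals
    have h := log_sub_one_div_le_logDeriv_Gamma_le_log (x := x + n) (by positivity)
    dsimp only
    linarith [h.1, h.2]

lemma tendsto_sum_one_div_sub_one_div {x y : ℝ} (hx : 0 < x) (hy : 0 < y) :
    Tendsto (fun n : ℕ => ∑ k ∈ Finset.range n, (1 / (y + k) - 1 / (x + k))) atTop
      (𝓝 (logDeriv Real.Gamma x - logDeriv Real.Gamma y)) := by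
  have h := ((tendsto_logDeriv_Gamma_add_nat_sub_log hy).sub
    (tendsto_logDeriv_Gamma_add_nat_sub_log hx)).add_const
      (logDeriv Real.Gamma x - logDeriv Real.Gamma y)
  rw [sub_zero, zero_add] at h
  refine h.congr fun n => ?_
  rw [Finset.sum_sub_distrib, logDeriv_Gamma_add_nat hx, logDeriv_Gamma_add_nat hy]
  ring

/-! ### `G₁` as a cardinal series -/

lemma norm_stepSamples_le (k : ℤ) : ‖stepSamples k‖ ≤ Real.pi := by
  rw [stepSamples]
  split_ifs
  · simpa using Real.pi_pos.le
  · simp [abs_of_pos Real.pi_pos]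

lemma stepSamples_mul_cardinalTerm_natCast {w z : ℂ} {k : ℕ} (hw : w ≠ k) (hz : z ≠ k) :
    stepSamples k * cardinalTerm w k z =
      Complex.sin (Real.pi * z) * (1 / (z - k) - 1 / (w - k)) := by
  have hπ : (Real.pi : ℂ) ≠ 0 := Complex.ofReal_ne_zero.2 Real.pi_ne_zero
  have hsign : ((-1 : ℂ) ^ (k : ℤ)) * (-1) ^ (k : ℤ) = 1 := by rw [← mul_zpow]; simp
  rw [stepSamples, if_neg (by lia),
    cardinalTerm_of_ne (by exact_mod_cast hw) (by exact_mod_cast hz), intGenFun, Int.cast_natCast]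
  field_simp
  linear_combination (Complex.sin (Real.pi * z) * (w - z)) * hsign

lemma cardinalSeries_stepSamples_neg_ofReal {x y : ℝ} (hx : 0 < x) (hy : 0 < y)
    (hyZ : ∀ k : ℤ, (-y : ℂ) ≠ k) :
    cardinalSeries stepSamples (-y) (-x) = Complex.sin (Real.pi * -x) *
      (Complex.digamma x - Complex.digamma y) := by
  have hne : ∀ {t : ℝ}, 0 < t → ∀ k : ℕ, (-t : ℂ) ≠ k := fun ht k h =>
    ofReal_ne_neg_natCast ht k (by rw [← h, neg_neg])
  have hsum := ((Nat.cast_injective (R := ℤ)).hasSum_iff fun k hk => by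
    rw [stepSamples, if_pos (by simpa using hk), zero_mul]).2
      (summable_cardinalSeries norm_stepSamples_le hyZ (-x)).hasSum
  refine tendsto_nhds_unique hsum.tendsto_sum_nat ?_
  have hlim := ((Complex.continuous_ofReal.tendsto _).comp
    (tendsto_sum_one_div_sub_one_div hx hy)).const_mul (Complex.sin (Real.pi * -x))
  rw [Complex.ofReal_sub, ← digamma_ofReal hx, ← digamma_ofReal hy] at hlim
  refine hlim.congr fun n => ?_
  rw [Function.comp_apply, Complex.ofReal_sum, Finset.mul_sum]
  refine Finset.sum_congr rfl fun k _ => ?_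
  rw [Function.comp_apply, stepSamples_mul_cardinalTerm_natCast (hne hy k) (hne hx k)]
  push_cast
  rw [← neg_add', ← neg_add', one_div_neg_eq_neg_one_div, one_div_neg_eq_neg_one_div]
  ring

lemma isClosed_image_natCast (s : Set ℕ) : IsClosed (((↑) : ℕ → ℂ) '' s) := by
  rw [← Set.image_congr fun (n : ℕ) _ => Int.cast_natCast (R := ℂ) n, ← Set.image_image]
  exact Complex.isClosedEmbedding_intCast.isClosedMap _ (isClosed_discrete _)

lemma eventually_ne_natCast (z : ℂ) : ∀ᶠ w : ℂ in 𝓝[≠] z, ∀ n : ℕ, w ≠ n := by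
  have hz : z ∈ (((↑) : ℕ → ℂ) '' {n : ℕ | (n : ℂ) ≠ z})ᶜ := by
    rintro ⟨n, hn, rfl⟩
    exact hn rfl
  filter_upwards [self_mem_nhdsWithin, mem_nhdsWithin_of_mem_nhds
    ((isClosed_image_natCast _).isOpen_compl.mem_nhds hz)] with w hw hw' n hn
  exact hw' ⟨n, fun h => hw (hn.trans h), hn.symm⟩

lemma analyticAt_digamma {s : ℂ} (hs : ∀ n : ℕ, s ≠ -n) : AnalyticAt ℂ Complex.digamma s := by
  have hGamma : AnalyticAt ℂ Complex.Gamma s := by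
    rw [Complex.analyticAt_iff_eventually_differentiableAt]
    have hopen := (isClosed_image_natCast Set.univ).isOpen_compl.preimage continuous_neg
    filter_upwards [hopen.mem_nhds (x := s) (by
      rintro ⟨n, -, hn⟩
      exact hs n (by rw [hn, neg_neg]))] with w hw
    exact Complex.differentiableAt_Gamma w fun n hn => hw ⟨n, trivial, by simp [hn]⟩
  exact hGamma.deriv.div hGamma (Complex.Gamma_ne_zero hs)

lemma neg_half_ne_intCast (k : ℤ) : (-(1 / 2 : ℝ) : ℂ) ≠ k := by
  intro h
  have h2 : (-(1 / 2) : ℝ) = k := by exact_mod_cast h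
  have h3 : -1 = 2 * k := by
    have : (-1 : ℝ) = 2 * k := by linarith
    exact_mod_cast this
  lia

/-- The cardinal series of the step samples, normalized at `-1/2` to agree with `G₁`. -/
def stepSeries (z : ℂ) : ℂ :=
  cardinalSeries stepSamples (-(1 / 2 : ℝ)) z +
    Complex.digamma (1 / 2 : ℝ) * Complex.sin (Real.pi * z)

lemma differentiable_stepSeries : Differentiable ℂ stepSeries := by
  have := differentiable_cardinalSeries norm_stepSamples_le neg_half_ne_intCast
  unfold stepSeries
  fun_prop

lemma stepSeries_neg_ofReal {x : ℝ} (hx : 0 < x) :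
    stepSeries (-x) = Complex.sin (Real.pi * -x) * Complex.digamma x := by
  rw [stepSeries, cardinalSeries_stepSamples_neg_ofReal hx one_half_pos neg_half_ne_intCast]
  ring

lemma stepSeries_eq_sin_mul_digamma {z : ℂ} (hz : ∀ n : ℕ, z ≠ n) :
    stepSeries z = Complex.sin (Real.pi * z) * Complex.digamma (-z) := by
  have hmem : ∀ {w : ℂ}, w ∈ (Set.range ((↑) : ℕ → ℂ))ᶜ ↔ ∀ n : ℕ, w ≠ n := by
    simp [Set.mem_range, eq_comm]
  have hconn : IsPreconnected (Set.range ((↑) : ℕ → ℂ))ᶜ :=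
    ((Set.countable_range _).isPathConnected_compl_of_one_lt_rank
      (by simp [Complex.rank_real_complex])).isConnected.isPreconnected
  refine AnalyticOnNhd.eqOn_of_preconnected_of_frequently_eq (f := stepSeries)
    (g := fun z => Complex.sin (Real.pi * z) * Complex.digamma (-z)) (z₀ := ((-1 : ℝ) : ℂ))
    (fun w _ => differentiable_stepSeries.analyticAt w) (fun w hw => ?_) hconn
    (hmem.2 fun n h => ?_) ?_ (hmem.2 hz)
  · exact (Differentiable.analyticAt (by fun_prop) w).mul ((analyticAt_digamma fun n hn =>
      hmem.1 hw n (neg_injective hn)).fun_comp analyticAt_id.neg)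
  · exact ofReal_ne_neg_natCast one_pos n (by rw [← h]; simp)
  · have hlim : Tendsto ((↑) : ℝ → ℂ) (𝓝[≠] (-1)) (𝓝[≠] ((-1 : ℝ) : ℂ)) :=
      Complex.continuous_ofReal.continuousAt.continuousWithinAt.tendsto_nhdsWithin
        fun y hy h => hy (Complex.ofReal_injective h)
    refine hlim.frequently (Eventually.frequently ?_)
    filter_upwards [mem_nhdsWithin_of_mem_nhds (Iio_mem_nhds neg_one_lt_zero)] with y hy
    simpa using stepSeries_neg_ofReal (neg_pos.2 hy)

lemma G₁_eq_stepSeries : G₁ = stepSeries := by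
  funext z
  refine Tendsto.limUnder_eq (((differentiable_stepSeries.continuous.tendsto z).mono_left
    nhdsWithin_le_nhds).congr' ?_)
  filter_upwards [eventually_ne_natCast z] with w hw using stepSeries_eq_sin_mul_digamma hw

lemma G₁_of_ne_natCast {z : ℂ} (hz : ∀ n : ℕ, z ≠ n) :
    G₁ z = Complex.sin (Real.pi * z) * Complex.digamma (-z) := by
  rw [G₁_eq_stepSeries, stepSeries_eq_sin_mul_digamma hz]

lemma differentiable_G₁ : Differentiable ℂ G₁ := G₁_eq_stepSeries ▸ differentiable_stepSeries

lemma continuous_G₁_ofReal : Continuous fun x : ℝ => G₁ x :=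
  differentiable_G₁.continuous.comp Complex.continuous_ofReal

lemma sin_pi_mul_eq (z : ℂ) : Complex.sin (Real.pi * z) = Real.pi * intGenFun z := by
  rw [intGenFun, mul_div_cancel₀ _ (Complex.ofReal_ne_zero.2 Real.pi_ne_zero)]

lemma G₁_intCast (k : ℤ) : G₁ k = stepSamples k := by
  rw [G₁_eq_stepSeries, stepSeries, cardinalSeries_intCast _ (neg_half_ne_intCast k),
    sin_pi_mul_eq, intGenFun_intCast, mul_zero, mul_zero, add_zero]

lemma G₁_mem_paleyWienerPlus : G₁ ∈ PaleyWienerPlus 1 := by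
  obtain ⟨B, hB⟩ := exists_norm_cardinalSeries_le norm_stepSamples_le neg_half_ne_intCast
  set C := ‖Complex.digamma (1 / 2 : ℝ)‖
  refine mem_paleyWienerPlus_of_norm_le (B := B + C * Real.pi) differentiable_G₁ fun z => ?_
  set e := Real.exp (Real.pi * |z.im|)
  have he : 0 < e := Real.exp_pos _
  have hsin : ‖Complex.digamma (1 / 2 : ℝ) * Complex.sin (Real.pi * z)‖ ≤
      C * Real.pi * ((1 + ‖z‖) * e) := by
    rw [sin_pi_mul_eq, norm_mul, norm_mul, Complex.norm_real, Real.norm_of_nonneg Real.pi_pos.le,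
      mul_assoc C]
    gcongr
    exact (norm_intGenFun_le z).trans (le_mul_of_one_le_left he.le (by simp))
  rw [mul_one, add_mul, G₁_eq_stepSeries]
  exact norm_add_le_of_le (hB z) hsin

lemma exists_isBandlimitedInterp_stepSamples {x : ℝ} (hx : ∀ k : ℤ, x ≠ k) (a' : ℂ) :
    ∃ c : ℂ, IsBandlimitedInterp stepSamples x a'
      fun z => G₁ z + c * Complex.sin (Real.pi * z) := by
  have h := isBandlimitedInterp_cardinalSeries norm_stepSamples_le hx a'
  have hx' : ∀ k : ℤ, (x : ℂ) ≠ k := fun k => by exact_mod_cast hx k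
  simp only [cardinalSeries_change_base norm_stepSamples_le hx' neg_half_ne_intCast] at h
  have hS := intGenFun_ne_zero hx'
  have hπ : (Real.pi : ℂ) ≠ 0 := Complex.ofReal_ne_zero.2 Real.pi_ne_zero
  refine ⟨(a' - cardinalSeries stepSamples (-(1 / 2 : ℝ)) x) / (Real.pi * intGenFun x) -
    Complex.digamma (1 / 2 : ℝ), ?_⟩
  convert h using 2 with z
  rw [G₁_eq_stepSeries, stepSeries, sin_pi_mul_eq]
  field_simp
  ring

/-! ### The size of `G₁` on the real line -/

lemma G₁_add_one_add_G₁ (x : ℝ) :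
    G₁ (x + 1 : ℝ) + G₁ x = Real.pi * Real.sinc (Real.pi * (x + 1)) := by
  have hcont : Continuous fun x : ℝ => G₁ (x + 1 : ℝ) + G₁ x :=
    (continuous_G₁_ofReal.comp (continuous_add_const 1)).add continuous_G₁_ofReal
  have hcont' : Continuous fun x : ℝ => (Real.pi * Real.sinc (Real.pi * (x + 1)) : ℂ) := by
    have := Real.continuous_sinc
    fun_prop
  refine congrFun (hcont.ext_on ((Set.countable_range ((↑) : ℤ → ℝ)).dense_compl ℝ) hcont'
    fun y hy => ?_) x
  have hne : ∀ n : ℤ, (y : ℂ) ≠ n := fun n h => hy ⟨n, by exact_mod_cast h.symm⟩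
  have hy1 : y + 1 ≠ 0 := fun h => hy ⟨-1, by push_cast; linarith⟩
  have hrec := Complex.digamma_apply_add_one (-(y + 1)) fun m h => hne (m - 1) (by
    push_cast
    linear_combination -h)
  have hsin : Complex.sin (Real.pi * (y + 1)) = -Complex.sin (Real.pi * y) := by
    rw [mul_add, mul_one, Complex.sin_add_pi]
  have hy1' : (y + 1 : ℂ) ≠ 0 := by exact_mod_cast hy1
  have hπ : (Real.pi : ℂ) ≠ 0 := Complex.ofReal_ne_zero.2 Real.pi_ne_zero
  dsimp only
  rw [G₁_of_ne_natCast (fun n h => hne (n - 1) (by push_cast at h ⊢; linear_combination h)),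
    G₁_of_ne_natCast (fun n h => hne n (by exact_mod_cast h)),
    Real.sinc_of_ne_zero (mul_ne_zero Real.pi_ne_zero hy1)]
  rw [show -((y : ℂ) + 1) + 1 = -y by ring] at hrec
  push_cast
  rw [hsin, hrec, inv_neg]
  field_simp
  ring

lemma sin_sq_mul_le_norm_G₁_neg {s : ℝ} (hs : 1 ≤ s) :
    Real.sin (Real.pi * s) ^ 2 * (Real.log s - 1) ≤ ‖G₁ (-s : ℝ)‖ := by
  have hs0 : 0 < s := one_pos.trans_le hs
  have hlog := (log_sub_one_div_le_logDeriv_Gamma_le_log hs0).1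
  have hinv : 1 / s ≤ 1 := (div_le_one hs0).2 hs
  have hnorm : ‖G₁ (-s : ℝ)‖ = |Real.sin (Real.pi * s)| * |logDeriv Real.Gamma s| := by
    rw [Complex.ofReal_neg, G₁_eq_stepSeries, stepSeries_neg_ofReal hs0, digamma_ofReal hs0,
      mul_neg, Complex.sin_neg, norm_mul, norm_neg, ← Complex.ofReal_mul, ← Complex.ofReal_sin,
      Complex.norm_real, Complex.norm_real, Real.norm_eq_abs, Real.norm_eq_abs]
  rw [hnorm, ← sq_abs]
  have h1 := Real.abs_sin_le_one (Real.pi * s)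
  have h2 := abs_nonneg (Real.sin (Real.pi * s))
  calc |Real.sin (Real.pi * s)| ^ 2 * (Real.log s - 1)
      ≤ |Real.sin (Real.pi * s)| ^ 2 * |logDeriv Real.Gamma s| := by
        gcongr
        exact (by linarith : _ ≤ _).trans (le_abs_self _)
    _ ≤ _ := mul_le_mul_of_nonneg_right (by nlinarith) (abs_nonneg _)

lemma integral_sin_pi_sq_ge (a b : ℝ) :
    (b - a) / 2 - 1 ≤ ∫ t in a..b, Real.sin (Real.pi * t) ^ 2 := by
  have habs : ∀ x : ℝ, |Real.sin x * Real.cos x| ≤ 1 := fun x => by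
    rw [abs_mul]
    exact mul_le_one₀ (Real.abs_sin_le_one _) (abs_nonneg _) (Real.abs_cos_le_one _)
  rw [intervalIntegral.integral_comp_mul_left (fun x => Real.sin x ^ 2) Real.pi_ne_zero,
    integral_sin_sq, smul_eq_mul, inv_mul_eq_div, le_div_iff₀ Real.pi_pos]
  nlinarith [Real.pi_gt_three, (abs_le.1 (habs (Real.pi * a))).1, (abs_le.1 (habs (Real.pi * b))).2]

lemma exists_mul_log_le_average_norm_G₁ : ∃ C : ℝ, 0 < C ∧ ∀ᶠ r : ℝ in atTop,
    C * Real.log r ≤ 1 / r * ∫ t in (-r)..0, ‖G₁ t‖ := by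
  refine ⟨1 / 16, by norm_num, ?_⟩
  filter_upwards [eventually_ge_atTop 8, Real.tendsto_log_atTop.eventually_ge_atTop
    (2 * (Real.log 2 + 1))] with r hr hlog
  have hr0 : 0 < r := by linarith
  have hcont := continuous_G₁_ofReal.norm
  set L := Real.log (r / 2) - 1 with hLdef
  have hL : Real.log r / 2 ≤ L := by
    rw [hLdef, Real.log_div hr0.ne' two_ne_zero]
    linarith
  have hlog0 : 0 ≤ Real.log r := Real.log_nonneg (by linarith)
  rw [one_div_mul_eq_div r, le_div_iff₀ hr0]
  calc 1 / 16 * Real.log r * r ≤ (-(r / 2) - -r) / 4 * L := by nlinarith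
    _ ≤ (∫ t in (-r)..(-(r / 2)), Real.sin (Real.pi * t) ^ 2) * L := by
        gcongr
        · linarith
        · linarith [integral_sin_pi_sq_ge (-r) (-(r / 2))]
    _ = ∫ t in (-r)..(-(r / 2)), Real.sin (Real.pi * t) ^ 2 * L :=
        (intervalIntegral.integral_mul_const _ _).symm
    _ ≤ ∫ t in (-r)..(-(r / 2)), ‖G₁ t‖ := by
        refine intervalIntegral.integral_mono_on (by linarith)
          (Continuous.intervalIntegrable (by fun_prop) _ _) (hcont.intervalIntegrable _ _)
          fun t ht => ?_
        have h := sin_sq_mul_le_norm_G₁_neg (s := -t) (by linarith [ht.2])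
        rw [neg_neg, mul_neg, Real.sin_neg, neg_sq] at h
        refine le_trans (mul_le_mul_of_nonneg_left ?_ (sq_nonneg _)) h
        exact sub_le_sub_right (Real.log_le_log (by linarith) (by linarith [ht.2])) 1
    _ ≤ ∫ t in (-r)..0, ‖G₁ t‖ :=
        intervalIntegral.integral_mono_interval le_rfl (by linarith) (by linarith)
          (Eventually.of_forall fun t => norm_nonneg _) (hcont.intervalIntegrable _ _)

lemma not_bddAbove_average_norm_G₁ :
    ¬ BddAbove ((fun r : ℝ => 1 / (2 * r) * ∫ t in (-r)..r, ‖G₁ t‖) '' Set.Ioi 0) := by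
  rintro ⟨M, hM⟩
  obtain ⟨C, hC, hlog⟩ := exists_mul_log_le_average_norm_G₁
  obtain ⟨r, hlow, hr, hlarge⟩ := (hlog.and ((eventually_gt_atTop 0).and
    (Real.tendsto_log_atTop.eventually_gt_atTop (2 * M / C)))).exists
  have hmono : ∫ t in (-r)..0, ‖G₁ t‖ ≤ ∫ t in (-r)..r, ‖G₁ t‖ :=
    intervalIntegral.integral_mono_interval le_rfl (by linarith) hr.le
      (Eventually.of_forall fun t => norm_nonneg _)
      (continuous_G₁_ofReal.norm.intervalIntegrable _ _)
  have hupp : 1 / (2 * r) * ∫ t in (-r)..r, ‖G₁ t‖ ≤ M := hM ⟨r, hr, rfl⟩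
  rw [one_div_mul_eq_div, div_le_iff₀ (by linarith)] at hupp
  rw [one_div_mul_eq_div, le_div_iff₀ hr] at hlow
  rw [div_lt_iff₀ hC] at hlarge
  nlinarith

lemma not_bounded_G₁_ofReal (M : ℝ) : ¬ ∀ x : ℝ, ‖G₁ x‖ ≤ M := by
  intro hM
  refine not_bddAbove_average_norm_G₁ ⟨M, ?_⟩
  rintro _ ⟨r, hr, rfl⟩
  have hr : 0 < r := hr
  have h := intervalIntegral.integral_mono_on (μ := volume) (a := -r) (b := r) (by linarith)
    (continuous_G₁_ofReal.norm.intervalIntegrable _ _) intervalIntegrable_const fun x _ => hM x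
  rw [intervalIntegral.integral_const, smul_eq_mul] at h
  dsimp only
  rw [one_div_mul_eq_div, div_le_iff₀ (by linarith)]
  linarith

/-! ### Bounded bandlimited functions -/

section Distribution

variable {E : Type*} [NormedAddCommGroup E] [NormedSpace ℝ E]

lemma exists_isOpen_isVanishingOn_cover {T : 𝓢'(E, ℂ)} {K : Set E} (hK : IsCompact K)
    (hd : Disjoint K (Distribution.dsupport T)) :
    ∃ (t : Finset E) (U : E → Set E), (∀ x, IsOpen (U x)) ∧ K ⊆ ⋃ x : t, U x ∧
      ∀ x ∈ t, Distribution.IsVanishingOn T (U x) := by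
  have hloc : ∀ x : E, ∃ s : Set E, IsOpen s ∧
      (x ∈ K → x ∈ s ∧ Distribution.IsVanishingOn T s) := by
    intro x
    by_cases hx : x ∈ K
    · obtain ⟨s, hs, hopen, hxs⟩ :=
        (Distribution.notMem_dsupport_iff x).1 (Set.disjoint_left.1 hd hx)
      exact ⟨s, hopen, fun _ => ⟨hxs, hs⟩⟩
    · exact ⟨∅, isOpen_empty, fun h => absurd h hx⟩
  choose U hUo hU using hloc
  obtain ⟨t, ht, hcover⟩ := hK.elim_nhds_subcover U fun x hx => (hUo x).mem_nhds (hU x hx).1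
  exact ⟨t, U, hUo, fun x hx => by simpa using hcover hx, fun x hx => (hU x (ht x hx)).2⟩

lemma apply_eq_zero_of_disjoint_dsupport [FiniteDimensional ℝ E] {T : 𝓢'(E, ℂ)} {u : 𝓢(E, ℂ)}
    (hc : HasCompactSupport u) (hd : Disjoint (tsupport u) (Distribution.dsupport T)) :
    T u = 0 := by
  obtain ⟨t, U, hUo, hcover, hU⟩ := exists_isOpen_isVanishingOn_cover hc.isCompact hd
  obtain ⟨ρ, hρ⟩ := SmoothPartitionOfUnity.exists_isSubordinate (modelWithCornersSelf ℝ E)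
    (isClosed_tsupport u) (fun i : t => U i) (fun i => hUo i) hcover
  have hsm : ∀ i : t, ContDiff ℝ (↑(⊤ : ℕ∞)) fun x => ((ρ i x : ℝ) : ℂ) * u x := fun i =>
    (Complex.ofRealCLM.contDiff.comp (contMDiff_iff_contDiff.1 (ρ i).contMDiff)).mul (u.smooth _)
  have hcs : ∀ i : t, HasCompactSupport fun x => ((ρ i x : ℝ) : ℂ) * u x := fun i => hc.mul_left
  have hu : u = ∑ i : t, (hcs i).toSchwartzMap (hsm i) := by
    ext x
    rw [sum_apply]
    simp only [HasCompactSupport.toSchwartzMap_toFun]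
    rw [← Finset.sum_mul, ← Complex.ofReal_sum]
    by_cases hx : x ∈ tsupport u
    · have hone := ρ.sum_eq_one hx
      rw [finsum_eq_sum_of_fintype] at hone
      rw [hone, Complex.ofReal_one, one_mul]
    · rw [image_eq_zero_of_notMem_tsupport hx, mul_zero]
  rw [hu, map_sum]
  refine Finset.sum_eq_zero fun i _ => hU i i.2 _ ((closure_mono fun x hx => ?_).trans (hρ i))
  simp only [Function.mem_support, HasCompactSupport.toSchwartzMap_toFun] at hx ⊢
  exact fun h => hx (by rw [h, Complex.ofReal_zero, zero_mul])

end Distribution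

/-- A bounded continuous function whose distributional Fourier transform is supported in
`[-b/2, b/2]`; this class describes the continuous representatives of the elements of `PW_b^∞`.
The spectral condition is tested on Schwartz functions with compact support. -/
structure IsBoundedBandlimited (b : ℝ) (g : ℝ → ℂ) : Prop where
  continuous : Continuous g
  exists_norm_le : ∃ M, ∀ x, ‖g x‖ ≤ M
  integral_fourier_mul_eq_zero : ∀ q : 𝓢(ℝ, ℂ), HasCompactSupport q →
    Disjoint (tsupport q) (Set.Icc (-(b / 2)) (b / 2)) → ∫ x, 𝓕 q x * g x = 0

lemma norm_le_of_ae_norm_le {X E : Type*} [TopologicalSpace X] [MeasurableSpace X]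
    {μ : Measure X} [μ.IsOpenPosMeasure] [SeminormedAddCommGroup E] {g : X → E}
    (hg : Continuous g) {M : ℝ} (hM : ∀ᵐ x ∂μ, ‖g x‖ ≤ M) (x : X) : ‖g x‖ ≤ M := by
  have heq : (fun x => max ‖g x‖ M) = fun _ => M :=
    ((hg.norm.max continuous_const).ae_eq_iff_eq μ continuous_const).1
      (hM.mono fun x hx => max_eq_right hx)
  exact max_eq_right_iff.1 (congrFun heq x)

lemma ae_norm_le_norm_Lp_top {α E : Type*} [MeasurableSpace α] {μ : Measure α}
    [NormedAddCommGroup E] (f : Lp E ⊤ μ) : ∀ᵐ x ∂μ, ‖f x‖ ≤ ‖f‖ := by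
  filter_upwards [ae_le_eLpNormEssSup (f := f) (μ := μ)] with x hx
  rw [← eLpNorm_exponent_top] at hx
  rw [Lp.norm_def, ← toReal_enorm]
  exact ENNReal.toReal_mono (Lp.eLpNorm_ne_top f) hx

lemma integrable_schwartzMap_mul (φ : 𝓢(ℝ, ℂ)) {g : ℝ → ℂ} (hg : Continuous g) {M : ℝ}
    (hM : ∀ x, ‖g x‖ ≤ M) : Integrable fun x => φ x * g x :=
  φ.integrable.mul_bdd hg.aestronglyMeasurable (Eventually.of_forall hM)

namespace IsBoundedBandlimited

variable {b : ℝ} {g g' : ℝ → ℂ}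

lemma of_mem_paleyWiener {f : Lp ℂ ⊤ (volume : Measure ℝ)} (hf : f ∈ PaleyWiener b ⊤)
    (hg : Continuous g) (hfg : f =ᵐ[volume] g) : IsBoundedBandlimited b g where
  continuous := hg
  exists_norm_le := ⟨‖f‖, norm_le_of_ae_norm_le hg <| by
    filter_upwards [hfg, ae_norm_le_norm_Lp_top f] with x hx h using hx ▸ h⟩
  integral_fourier_mul_eq_zero q hq hd := by
    have h := apply_eq_zero_of_disjoint_dsupport hq (hd.mono_right hf)
    rw [TemperedDistribution.fourier_apply, Lp.toTemperedDistribution_apply] at h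
    rw [← h]
    refine integral_congr_ae ?_
    filter_upwards [hfg] with x hx
    rw [hx, smul_eq_mul]

lemma integrable_mul (hg : IsBoundedBandlimited b g) (φ : 𝓢(ℝ, ℂ)) :
    Integrable fun x => φ x * g x := by
  obtain ⟨M, hM⟩ := hg.exists_norm_le
  exact integrable_schwartzMap_mul φ hg.continuous hM

lemma add (hg : IsBoundedBandlimited b g) (hg' : IsBoundedBandlimited b g') :
    IsBoundedBandlimited b fun x => g x + g' x where
  continuous := hg.continuous.add hg'.continuous
  exists_norm_le := by
    obtain ⟨⟨M, hM⟩, M', hM'⟩ := And.intro hg.exists_norm_le hg'.exists_norm_le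
    exact ⟨M + M', fun x => norm_add_le_of_le (hM x) (hM' x)⟩
  integral_fourier_mul_eq_zero q hq hd := by
    simp only [mul_add]
    rw [integral_add (hg.integrable_mul _) (hg'.integrable_mul _),
      hg.integral_fourier_mul_eq_zero q hq hd, hg'.integral_fourier_mul_eq_zero q hq hd, add_zero]

end IsBoundedBandlimited

lemma fourier_comp_sub_right (q : 𝓢(ℝ, ℂ)) (c x : ℝ) :
    𝓕 (SchwartzMap.compSubConstCLM ℂ c q) x =
      Complex.exp ((-2 * Real.pi * x * c : ℝ) * Complex.I) * 𝓕 q x := by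
  rw [SchwartzMap.fourier_coe, SchwartzMap.fourier_coe, Real.fourier_real_eq_integral_exp_smul,
    Real.fourier_real_eq_integral_exp_smul, ← integral_const_mul,
    ← integral_add_right_eq_self _ c]
  refine integral_congr_ae (Eventually.of_forall fun v => ?_)
  simp only [SchwartzMap.compSubConstCLM_apply, add_sub_cancel_right, smul_eq_mul, ← mul_assoc,
    ← Complex.exp_add]
  congr 2
  push_cast
  ring

lemma fourierInv_eq_fourier_neg (φ : 𝓢(ℝ, ℂ)) (v : ℝ) : 𝓕⁻ φ v = 𝓕 φ (-v) := by
  rw [SchwartzMap.fourierInv_coe, SchwartzMap.fourier_coe, Real.fourierInv_eq_fourier_neg]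

lemma IsBoundedBandlimited.comp_add_right {b : ℝ} {g : ℝ → ℂ} (hg : IsBoundedBandlimited b g)
    (c : ℝ) : IsBoundedBandlimited b fun x => g (x + c) where
  continuous := hg.continuous.comp (continuous_add_const c)
  exists_norm_le := hg.exists_norm_le.imp fun M hM x => hM (x + c)
  integral_fourier_mul_eq_zero q hq hd := by
    set p : 𝓢(ℝ, ℂ) := 𝓕⁻ (SchwartzMap.compSubConstCLM ℂ c (𝓕 q)) with hp
    have hpq : tsupport p ⊆ tsupport q := by
      have heq : ⇑p = fun v => Complex.exp ((-2 * Real.pi * -v * c : ℝ) * Complex.I) * q v := by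
        funext v
        rw [hp, fourierInv_eq_fourier_neg, fourier_comp_sub_right, ← fourierInv_eq_fourier_neg,
          FourierTransform.fourierInv_fourier_eq]
      rw [heq]
      exact tsupport_mul_subset_right
    have h := hg.integral_fourier_mul_eq_zero p
      (hq.of_isClosed_subset (isClosed_tsupport _) hpq) (hd.mono_left hpq)
    rw [hp, FourierTransform.fourier_fourierInv_eq, ← integral_add_right_eq_self _ c] at h
    simpa only [SchwartzMap.compSubConstCLM_apply, add_sub_cancel_right] using h

/-! ### Windowed Fourier transforms -/

lemma exists_schwartzMap_tsupport_fourierInv_subset :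
    ∃ φ : 𝓢(ℝ, ℂ), tsupport (𝓕⁻ φ : 𝓢(ℝ, ℂ)) ⊆ Set.Icc (-1) 1 ∧ φ 0 = 1 := by
  let η : ContDiffBump (0 : ℝ) := ⟨1 / 2, 1, by norm_num, by norm_num⟩
  have hsupp : tsupport (fun v => (η.normed volume v : ℂ)) ⊆ Set.Icc (-1) 1 := by
    refine (closure_mono (Function.support_comp_subset Complex.ofReal_zero _)).trans ?_
    rw [← tsupport, η.tsupport_normed_eq, Real.closedBall_eq_Icc]
    simp [η]
  have hc : HasCompactSupport fun v => (η.normed volume v : ℂ) :=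
    isCompact_Icc.of_isClosed_subset (isClosed_tsupport _) hsupp
  refine ⟨𝓕 (hc.toSchwartzMap (Complex.ofRealCLM.contDiff.comp η.contDiff_normed)), ?_, ?_⟩
  · rwa [FourierTransform.fourierInv_fourier_eq]
  · rw [SchwartzMap.fourier_coe, Real.fourier_real_eq_integral_exp_smul]
    simp only [mul_zero, Complex.ofReal_zero, zero_mul, Complex.exp_zero, one_smul]
    exact integral_complex_ofReal.trans (by rw [η.integral_normed, Complex.ofReal_one])

/-- The dilation `x ↦ φ (ε * x)` of a Schwartz function. -/
def dilation (φ : 𝓢(ℝ, ℂ)) {ε : ℝ} (hε : 0 < ε) : 𝓢(ℝ, ℂ) :=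
  SchwartzMap.compCLMOfContinuousLinearEquiv ℂ
    (ContinuousLinearEquiv.unitsEquivAut ℝ (Units.mk0 ε hε.ne')) φ

section Dilation

variable (φ : 𝓢(ℝ, ℂ)) {ε : ℝ} (hε : 0 < ε)

lemma dilation_apply (x : ℝ) : dilation φ hε x = φ (ε * x) := by
  simp [dilation, mul_comm]

lemma fourierInv_dilation (v : ℝ) : 𝓕⁻ (dilation φ hε) v = ε⁻¹ * 𝓕⁻ φ (v / ε) := by
  have h := Measure.integral_comp_mul_left
    (fun y : ℝ => Complex.exp ((2 * Real.pi * inner ℝ y (v / ε) : ℝ) * Complex.I) • φ y) ε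
  rw [abs_of_pos (inv_pos.2 hε), ← Real.fourierInv_eq' φ, ← SchwartzMap.fourierInv_coe] at h
  rw [SchwartzMap.fourierInv_coe, Real.fourierInv_eq', ← Complex.real_smul, ← h]
  refine integral_congr_ae (Eventually.of_forall fun x => ?_)
  simp only [RCLike.inner_apply, conj_trivial, dilation_apply]
  congr 4
  field_simp

lemma integral_norm_dilation : ∫ x, ‖dilation φ hε x‖ = ε⁻¹ * ∫ x, ‖φ x‖ := by
  simp only [dilation_apply]
  rw [Measure.integral_comp_mul_left (fun x => ‖φ x‖), abs_of_pos (inv_pos.2 hε), smul_eq_mul]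

lemma integral_norm_deriv_dilation : ∫ x, ‖deriv (dilation φ hε) x‖ = ∫ x, ‖deriv φ x‖ := by
  have hderiv : ∀ x, ‖deriv (dilation φ hε) x‖ = ε * ‖deriv φ (ε * x)‖ := fun x => by
    rw [funext (dilation_apply φ hε), deriv_comp_mul_left, norm_smul,
      Real.norm_of_nonneg hε.le]
  simp only [hderiv]
  rw [integral_const_mul, Measure.integral_comp_mul_left (fun x => ‖deriv φ x‖),
    abs_of_pos (inv_pos.2 hε), smul_eq_mul, mul_inv_cancel_left₀ hε.ne']

variable {φ}

lemma tsupport_fourierInv_dilation_subset (hφ : tsupport (𝓕⁻ φ : 𝓢(ℝ, ℂ)) ⊆ Set.Icc (-1) 1) :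
    tsupport (𝓕⁻ (dilation φ hε) : 𝓢(ℝ, ℂ)) ⊆ Set.Icc (-ε) ε := by
  refine closure_minimal (fun v hv => ?_) isClosed_Icc
  rw [Function.mem_support, fourierInv_dilation] at hv
  have h := hφ (subset_tsupport _ (right_ne_zero_of_mul hv))
  rwa [Set.mem_Icc, le_div_iff₀ hε, div_le_iff₀ hε, neg_one_mul, one_mul] at h

end Dilation

lemma IsBoundedBandlimited.fourier_mul_eq_zero {b : ℝ} {g : ℝ → ℂ}
    (hg : IsBoundedBandlimited b g) {φ : 𝓢(ℝ, ℂ)} {ε : ℝ}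
    (hφ : tsupport (𝓕⁻ φ : 𝓢(ℝ, ℂ)) ⊆ Set.Icc (-ε) ε) {ξ : ℝ} (hξ : b / 2 + ε < |ξ|) :
    𝓕 (fun x => φ x * g x) ξ = 0 := by
  set q := SchwartzMap.compSubConstCLM ℂ ξ (𝓕⁻ φ) with hq
  have hsupp : tsupport q ⊆ Set.Icc (ξ - ε) (ξ + ε) := by
    refine closure_minimal (fun v hv => ?_) isClosed_Icc
    have h := hφ (subset_tsupport _ (show 𝓕⁻ φ (v - ξ) ≠ 0 from hv))
    exact ⟨by linarith [h.1], by linarith [h.2]⟩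
  have hd : Disjoint (tsupport q) (Set.Icc (-(b / 2)) (b / 2)) := by
    refine Set.disjoint_left.2 fun v hv hvb => hξ.not_ge (abs_le.2 ?_)
    exact ⟨by linarith [(hsupp hv).2, hvb.1], by linarith [(hsupp hv).1, hvb.2]⟩
  rw [← hg.integral_fourier_mul_eq_zero q
    (isCompact_Icc.of_isClosed_subset (isClosed_tsupport _) hsupp) hd,
    Real.fourier_real_eq_integral_exp_smul]
  refine integral_congr_ae (Eventually.of_forall fun x => ?_)
  simp only [hq, fourier_comp_sub_right, FourierTransform.fourier_fourierInv_eq, smul_eq_mul,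
    mul_assoc]

lemma lintegral_enorm_comp_add_sub_le {E : Type*} [NormedAddCommGroup E] [NormedSpace ℝ E]
    [CompleteSpace E] {f : ℝ → E} (hf : ContDiff ℝ 1 f) {t : ℝ} (ht : 0 ≤ t) :
    ∫⁻ s, ‖f (s + t) - f s‖ₑ ≤ ENNReal.ofReal t * ∫⁻ s, ‖deriv f s‖ₑ := by
  have hcont := hf.continuous_deriv le_rfl
  have hFTC : ∀ s, f (s + t) - f s = ∫ r in Set.Ioc 0 t, deriv f (s + r) := fun s => by
    rw [← intervalIntegral.integral_of_le ht, intervalIntegral.integral_comp_add_left, add_zero,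
      intervalIntegral.integral_deriv_eq_sub
        (fun x _ => (hf.differentiable one_ne_zero).differentiableAt)
        (hcont.intervalIntegrable _ _)]
  calc ∫⁻ s, ‖f (s + t) - f s‖ₑ
      ≤ ∫⁻ s, ∫⁻ r in Set.Ioc 0 t, ‖deriv f (s + r)‖ₑ :=
        lintegral_mono fun s => hFTC s ▸ enorm_integral_le_lintegral_enorm _
    _ = ∫⁻ r in Set.Ioc 0 t, ∫⁻ s, ‖deriv f (s + r)‖ₑ :=
        lintegral_lintegral_swap
          (Continuous.measurable (by fun_prop : Continuous fun p : ℝ × ℝ =>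
            ‖deriv f (p.1 + p.2)‖ₑ)).aemeasurable
    _ = ENNReal.ofReal t * ∫⁻ s, ‖deriv f s‖ₑ := by
        simp only [lintegral_add_right_eq_self fun s => ‖deriv f s‖ₑ, lintegral_const,
          Measure.restrict_apply_univ, Real.volume_Ioc, sub_zero, mul_comm]

lemma integral_norm_comp_add_one_sub_le (φ : 𝓢(ℝ, ℂ)) :
    ∫ s, ‖φ (s + 1) - φ s‖ ≤ ∫ s, ‖deriv φ s‖ := by
  have hderiv : Integrable (deriv φ) := (SchwartzMap.derivCLM ℂ ℂ φ).integrable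
  rw [integral_norm_eq_lintegral_enorm (by fun_prop),
    integral_norm_eq_lintegral_enorm hderiv.aestronglyMeasurable]
  refine ENNReal.toReal_mono hderiv.2.ne ?_
  simpa using lintegral_enorm_comp_add_sub_le (φ.smooth 1) zero_le_one

lemma norm_one_add_exp_le {ξ : ℝ} {δ : ℝ} (hξ : |(|ξ| - 1 / 2)| ≤ δ) :
    ‖1 + Complex.exp ((2 * Real.pi * ξ : ℝ) * Complex.I)‖ ≤ 2 * Real.pi * δ := by
  obtain ⟨m, hm, hexp⟩ : ∃ m : ℝ, |ξ - m| = |(|ξ| - 1 / 2)| ∧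
      Complex.exp ((2 * Real.pi * m : ℝ) * Complex.I) = -1 := by
    rcases le_total 0 ξ with h | h
    · refine ⟨1 / 2, by rw [abs_of_nonneg h], ?_⟩
      rw [← Complex.exp_pi_mul_I]
      congr 2
      push_cast
      ring
    · refine ⟨-(1 / 2), by rw [abs_of_nonpos h, ← abs_neg]; ring_nf, ?_⟩
      rw [← Complex.exp_neg_pi_mul_I]
      congr 2
      push_cast
      ring
  have hsplit : 1 + Complex.exp ((2 * Real.pi * ξ : ℝ) * Complex.I) =
      -(Complex.exp (Complex.I * (2 * Real.pi * (ξ - m) : ℝ)) - 1) := by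
    have hadd : ((2 * Real.pi * ξ : ℝ) : ℂ) * Complex.I =
        Complex.I * (2 * Real.pi * (ξ - m) : ℝ) + (2 * Real.pi * m : ℝ) * Complex.I := by
      push_cast
      ring
    rw [hadd, Complex.exp_add, hexp]
    ring
  rw [hsplit, norm_neg]
  refine Real.norm_exp_I_mul_ofReal_sub_one_le.trans ?_
  rw [norm_mul, Real.norm_of_nonneg Real.two_pi_pos.le, Real.norm_eq_abs, hm]
  gcongr

lemma fourier_mul_comp_add_one_add {g φ : ℝ → ℂ}
    (h₁ : Integrable fun x => φ x * g (x + 1)) (h₀ : Integrable fun x => φ x * g x) (ξ : ℝ) :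
    𝓕 (fun x => φ x * (g (x + 1) + g x)) ξ =
      ∫ x, Complex.exp ((-2 * Real.pi * (x + 1) * ξ : ℝ) * Complex.I) *
        (((1 + Complex.exp ((2 * Real.pi * ξ : ℝ) * Complex.I)) * φ x +
          (φ (x + 1) - φ x)) * g (x + 1)) := by
  have hint : ∀ {u : ℝ → ℂ}, Integrable u →
      Integrable fun x => Complex.exp ((-2 * Real.pi * x * ξ : ℝ) * Complex.I) * u x := by
    intro u hu
    refine hu.bdd_mul (c := 1) (by fun_prop) (Eventually.of_forall fun x => ?_)
    rw [Complex.norm_exp_ofReal_mul_I]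
  have h₀' := (hint h₀).comp_add_right 1
  rw [Real.fourier_real_eq_integral_exp_smul]
  simp only [smul_eq_mul, mul_add]
  rw [integral_add (hint h₁) (hint h₀),
    ← integral_add_right_eq_self (fun x => _ * (φ x * g x)) 1, ← integral_add (hint h₁) h₀']
  refine integral_congr_ae (Eventually.of_forall fun x => ?_)
  have hexp : Complex.exp ((-2 * Real.pi * x * ξ : ℝ) * Complex.I) =
      Complex.exp ((-2 * Real.pi * (x + 1) * ξ : ℝ) * Complex.I) *
        Complex.exp ((2 * Real.pi * ξ : ℝ) * Complex.I) := by
    rw [← Complex.exp_add]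
    congr 1
    push_cast
    ring
  simp only [hexp, mul_one]
  ring_nf

lemma norm_fourier_mul_comp_add_one_add_le {g : ℝ → ℂ} (hg : Continuous g) {M : ℝ}
    (hM : ∀ x, ‖g x‖ ≤ M) (φ : 𝓢(ℝ, ℂ)) (ξ : ℝ) :
    ‖𝓕 (fun x => φ x * (g (x + 1) + g x)) ξ‖ ≤
      (‖1 + Complex.exp ((2 * Real.pi * ξ : ℝ) * Complex.I)‖ * (∫ x, ‖φ x‖) +
        ∫ x, ‖deriv φ x‖) * M := by
  set ω := Complex.exp ((2 * Real.pi * ξ : ℝ) * Complex.I)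
  have hM₀ : 0 ≤ M := (norm_nonneg _).trans (hM 0)
  have hdiff : Integrable fun x => ‖φ (x + 1) - φ x‖ :=
    ((φ.integrable.comp_add_right 1).sub φ.integrable).norm
  have hφ : Integrable fun x => ‖1 + ω‖ * ‖φ x‖ := φ.integrable.norm.const_mul _
  rw [fourier_mul_comp_add_one_add
    (integrable_schwartzMap_mul φ (hg.comp (continuous_add_const 1)) fun x => hM (x + 1))
    (integrable_schwartzMap_mul φ hg hM)]
  calc _ ≤ ∫ x, (‖1 + ω‖ * ‖φ x‖ + ‖φ (x + 1) - φ x‖) * M := by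
        refine norm_integral_le_of_norm_le ((hφ.add hdiff).mul_const M)
          (Eventually.of_forall fun x => ?_)
        rw [norm_mul, Complex.norm_exp_ofReal_mul_I, one_mul, norm_mul]
        gcongr
        · exact (norm_add_le _ _).trans_eq (by rw [norm_mul])
        · exact hM _
    _ = (‖1 + ω‖ * (∫ x, ‖φ x‖) + ∫ x, ‖φ (x + 1) - φ x‖) * M := by
        rw [integral_mul_const, integral_add hφ hdiff, integral_const_mul]
    _ ≤ _ :=
        mul_le_mul_of_nonneg_right (add_le_add le_rfl (integral_norm_comp_add_one_sub_le φ)) hM₀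

lemma fourier_exp_mul (h : ℝ → ℂ) (ξ η : ℝ) :
    𝓕 (fun x => Complex.exp ((-2 * Real.pi * x * ξ : ℝ) * Complex.I) * h x) η =
      𝓕 h (ξ + η) := by
  rw [Real.fourier_real_eq_integral_exp_smul, Real.fourier_real_eq_integral_exp_smul]
  refine integral_congr_ae (Eventually.of_forall fun x => ?_)
  simp only [smul_eq_mul, ← mul_assoc, ← Complex.exp_add]
  congr 2
  push_cast
  ring

lemma fourier_eq_of_forall_intCast_eq_zero {h : ℝ → ℂ} (hc : Continuous h) {b : ℝ} (hb : 1 < b)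
    (hO : h =O[cocompact ℝ] (|·| ^ (-b))) {n : ℤ} (hn : ∀ k ≠ n, h k = 0) {ξ : ℝ}
    (hξ : ∀ m : ℤ, m ≠ 0 → 𝓕 h (ξ + m) = 0) :
    𝓕 h ξ = Complex.exp ((-2 * Real.pi * n * ξ : ℝ) * Complex.I) * h n := by
  set u : ℝ → ℂ := fun x => Complex.exp ((-2 * Real.pi * x * ξ : ℝ) * Complex.I) * h x with hu
  have hû : ∀ m : ℤ, m ≠ 0 → 𝓕 u m = 0 := fun m hm => by rw [hu, fourier_exp_mul, hξ m hm]
  have huO : u =O[cocompact ℝ] (|·| ^ (-b)) :=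
    (Asymptotics.isBigO_of_le _ fun x => by
      rw [hu, norm_mul, Complex.norm_exp_ofReal_mul_I, one_mul]).trans hO
  have hsummable : Summable fun m : ℤ => 𝓕 u m :=
    summable_of_ne_finset_zero (s := {0}) fun m hm => hû m (by simpa using hm)
  have hpoisson := Real.tsum_eq_tsum_fourier_of_rpow_decay_of_summable
    (by fun_prop) hb huO hsummable 0
  simp only [zero_add, QuotientAddGroup.mk_zero, fourier_eval_zero, mul_one] at hpoisson
  rw [tsum_eq_single n fun k hk => by rw [hu]; simp only [hn k hk, mul_zero],
    tsum_eq_single 0 hû] at hpoisson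
  rw [← add_zero ξ, ← fourier_exp_mul, add_zero, ← hu, ← Int.cast_zero, ← hpoisson]

lemma integral_exp_eq_sinc (y : ℝ) :
    ∫ ξ in (-(1 / 2) : ℝ)..1 / 2, Complex.exp ((2 * Real.pi * y * ξ : ℝ) * Complex.I) =
      Real.sinc (Real.pi * y) := by
  rcases eq_or_ne y 0 with rfl | hy
  · norm_num
  have h := intervalIntegral.smul_integral_comp_mul_left (a := -(1 / 2)) (b := 1 / 2)
    (fun t : ℝ => Complex.exp (t * Complex.I)) (2 * Real.pi * y)
  rw [show 2 * Real.pi * y * -(1 / 2) = -(Real.pi * y) by ring,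
    show 2 * Real.pi * y * (1 / 2) = Real.pi * y by ring, integral_exp_mul_I_eq_sinc,
    Complex.real_smul] at h
  have hne : ((2 * Real.pi * y : ℝ) : ℂ) ≠ 0 :=
    Complex.ofReal_ne_zero.2 (mul_ne_zero Real.two_pi_pos.ne' hy)
  refine mul_left_cancel₀ hne ?_
  rw [h]
  push_cast
  ring

namespace IsBoundedBandlimited

variable {b : ℝ} {w : ℝ → ℂ} {φ : 𝓢(ℝ, ℂ)} {ε : ℝ} {n : ℤ}

lemma isBigO_mul (hw : IsBoundedBandlimited b w) (φ : 𝓢(ℝ, ℂ)) (s : ℝ) :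
    (fun x => φ x * w x) =O[cocompact ℝ] (|·| ^ s) := by
  obtain ⟨M, hM⟩ := hw.exists_norm_le
  simpa only [mul_one, Real.norm_eq_abs] using (φ.isBigO_cocompact_rpow s).mul
    (Asymptotics.IsBigO.of_bound M (g := fun _ => (1 : ℝ)) (Eventually.of_forall fun x => by
      simpa only [norm_one, mul_one] using hM x))

lemma fourier_mul_eq_of_forall_intCast_eq_zero (hw : IsBoundedBandlimited b w)
    (hφ : tsupport (𝓕⁻ φ : 𝓢(ℝ, ℂ)) ⊆ Set.Icc (-ε) ε) (hn : ∀ k ≠ n, w k = 0) {ξ : ℝ}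
    (hξ : |ξ| + b / 2 + ε < 1) :
    𝓕 (fun x => φ x * w x) ξ =
      Complex.exp ((-2 * Real.pi * n * ξ : ℝ) * Complex.I) * (φ n * w n) := by
  have hmul : Continuous fun y => φ y * w y := φ.continuous.mul hw.continuous
  refine fourier_eq_of_forall_intCast_eq_zero hmul one_lt_two
    (hw.isBigO_mul φ (-2)) (fun k hk => by rw [hn k hk, mul_zero]) fun m hm =>
      hw.fourier_mul_eq_zero hφ ?_
  have hm₁ : (1 : ℝ) ≤ |(m : ℝ)| := by exact_mod_cast Int.one_le_abs hm
  have htri : |(m : ℝ)| ≤ |ξ + m| + |ξ| := by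
    simpa only [add_sub_cancel_left] using abs_sub (ξ + m) ξ
  linarith

lemma mul_eq_integral_fourier (hw : IsBoundedBandlimited b w)
    (hφ : tsupport (𝓕⁻ φ : 𝓢(ℝ, ℂ)) ⊆ Set.Icc (-ε) ε) (x : ℝ) :
    φ x * w x = ∫ ξ, Complex.exp ((2 * Real.pi * x * ξ : ℝ) * Complex.I) *
      𝓕 (fun y => φ y * w y) ξ := by
  have hint := hw.integrable_mul φ
  have hmul : Continuous fun y => φ y * w y := φ.continuous.mul hw.continuous
  have hcont : Continuous (𝓕 fun y => φ y * w y) :=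
    VectorFourier.fourierIntegral_continuous Real.continuous_fourierChar continuous_inner hint
  have hsupp : HasCompactSupport (𝓕 fun y => φ y * w y) :=
    HasCompactSupport.intro (isCompact_Icc (a := -(b / 2 + ε)) (b := b / 2 + ε)) fun ξ hξ =>
      hw.fourier_mul_eq_zero hφ (not_le.1 fun h => hξ (abs_le.1 h))
  have hinv := congrFun (hmul.fourierInv_fourier_eq hint
    (hcont.integrable_of_hasCompactSupport hsupp)) x
  rw [Real.fourierInv_eq'] at hinv
  rw [← hinv]
  simp only [RCLike.inner_apply, conj_trivial, smul_eq_mul, mul_assoc, mul_comm x]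

-- The samples determine the transform only away from `|ξ| = 1/2`. Near the edge, the factor
-- `1 + e^{2πiξ} = O(ε)` compensates for `‖φ(ε ·)‖₁ = O(1/ε)`.
lemma exists_norm_fourier_dilation_mul_le {g : ℝ → ℂ} (hg : IsBoundedBandlimited 1 g)
    (hφ : tsupport (𝓕⁻ φ : 𝓢(ℝ, ℂ)) ⊆ Set.Icc (-1) 1) (hn : ∀ k : ℤ, k ≠ n → g (k + 1) + g k = 0) :
    ∃ C, ∀ {ε : ℝ} (hε : 0 < ε) (ξ : ℝ),
      ‖𝓕 (fun x => dilation φ hε x * (g (x + 1) + g x)) ξ‖ ≤ C := by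
  obtain ⟨M, hM⟩ := hg.exists_norm_le
  obtain ⟨A, -, hA⟩ := φ.decay 0 0
  simp only [pow_zero, one_mul, norm_iteratedFDeriv_zero] at hA
  have hw := (hg.comp_add_right 1).add hg
  have hM₀ : 0 ≤ M := (norm_nonneg _).trans (hM 0)
  have hA₀ : 0 ≤ A * ‖g (n + 1) + g n‖ :=
    mul_nonneg ((norm_nonneg _).trans (hA 0)) (norm_nonneg _)
  set K := (2 * Real.pi * (∫ x, ‖φ x‖) + ∫ x, ‖deriv φ x‖) * M with hK
  have hK₀ : 0 ≤ K := by positivity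
  refine ⟨K + A * ‖g (n + 1) + g n‖, fun {ε} hε ξ => ?_⟩
  have hφε := tsupport_fourierInv_dilation_subset hε hφ
  rcases lt_or_ge (1 / 2 + ε) |ξ| with hout | hle
  · rw [hw.fourier_mul_eq_zero hφε hout, norm_zero]
    positivity
  rcases lt_or_ge |ξ| (1 / 2 - ε) with hin | hge
  · rw [hw.fourier_mul_eq_of_forall_intCast_eq_zero hφε hn (by linarith), norm_mul,
      Complex.norm_exp_ofReal_mul_I, one_mul, norm_mul, dilation_apply]
    exact (mul_le_mul_of_nonneg_right (hA _) (norm_nonneg _)).trans (le_add_of_nonneg_left hK₀)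
  · have hedge := norm_one_add_exp_le (abs_le.2 ⟨by linarith, by linarith⟩ : |(|ξ| - 1 / 2)| ≤ ε)
    refine (norm_fourier_mul_comp_add_one_add_le hg.continuous hM (dilation φ hε) ξ).trans
      (le_add_of_le_of_nonneg ?_ hA₀)
    rw [hK, integral_norm_dilation, integral_norm_deriv_dilation]
    have hI : 0 ≤ ε⁻¹ * ∫ x, ‖φ x‖ := by positivity
    have hcancel : 2 * Real.pi * ε * (ε⁻¹ * ∫ x, ‖φ x‖) = 2 * Real.pi * ∫ x, ‖φ x‖ := by
      rw [mul_assoc _ ε, mul_inv_cancel_left₀ hε.ne']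
    exact mul_le_mul_of_nonneg_right
      (add_le_add ((mul_le_mul_of_nonneg_right hedge hI).trans_eq hcancel) le_rfl) hM₀

lemma tendsto_fourier_dilation_mul (hw : IsBoundedBandlimited 1 w)
    (hφ : tsupport (𝓕⁻ φ : 𝓢(ℝ, ℂ)) ⊆ Set.Icc (-1) 1) (hφ₀ : φ 0 = 1) (hn : ∀ k ≠ n, w k = 0)
    {ε : ℕ → ℝ} (hε : ∀ j, 0 < ε j) (hε₀ : Tendsto ε atTop (𝓝 0)) {ξ : ℝ} (hξ : |ξ| ≠ 1 / 2) :
    Tendsto (fun j => 𝓕 (fun y => dilation φ (hε j) y * w y) ξ) atTop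
      (𝓝 ((Set.Ioc (-(1 / 2)) (1 / 2)).indicator
        (fun η => Complex.exp ((-2 * Real.pi * n * η : ℝ) * Complex.I) * w n) ξ)) := by
  have hφε := fun j => tsupport_fourierInv_dilation_subset (hε j) hφ
  rcases hξ.lt_or_gt with hin | hout
  · have hmem : ξ ∈ Set.Ioc (-(1 / 2) : ℝ) (1 / 2) :=
      Set.Ioo_subset_Ioc_self (abs_lt.1 hin)
    have hφn : Tendsto (fun j => φ (ε j * n)) atTop (𝓝 1) := by
      have h := (φ.continuous.tendsto (0 * n)).comp (hε₀.mul_const (n : ℝ))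
      rwa [zero_mul, hφ₀] at h
    rw [Set.indicator_of_mem hmem, ← one_mul (w n)]
    refine ((hφn.mul_const (w n)).const_mul _).congr' ?_
    filter_upwards [hε₀.eventually_lt_const (sub_pos.2 hin)] with j hj
    rw [hw.fourier_mul_eq_of_forall_intCast_eq_zero (hφε j) hn (by linarith), dilation_apply]
  · have hmem : ξ ∉ Set.Ioc (-(1 / 2) : ℝ) (1 / 2) := fun h =>
      hout.not_ge (abs_le.2 (Set.Ioc_subset_Icc_self h))
    rw [Set.indicator_of_notMem hmem]
    refine tendsto_const_nhds.congr' ?_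
    filter_upwards [hε₀.eventually_lt_const (sub_pos.2 hout)] with j hj
    rw [hw.fourier_mul_eq_zero (hφε j) (by linarith)]

lemma tendsto_integral_fourier_dilation_mul (hw : IsBoundedBandlimited 1 w)
    (hφ : tsupport (𝓕⁻ φ : 𝓢(ℝ, ℂ)) ⊆ Set.Icc (-1) 1) (hφ₀ : φ 0 = 1) (hn : ∀ k ≠ n, w k = 0)
    {C : ℝ} (hC : ∀ {ε : ℝ} (hε : 0 < ε) (ξ : ℝ), ‖𝓕 (fun x => dilation φ hε x * w x) ξ‖ ≤ C)
    {ε : ℕ → ℝ} (hε : ∀ j, 0 < ε j) (hε₀ : Tendsto ε atTop (𝓝 0)) (x : ℝ) :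
    Tendsto (fun j => ∫ ξ, Complex.exp ((2 * Real.pi * x * ξ : ℝ) * Complex.I) *
        𝓕 (fun y => dilation φ (hε j) y * w y) ξ) atTop
      (𝓝 (∫ ξ, Complex.exp ((2 * Real.pi * x * ξ : ℝ) * Complex.I) *
        (Set.Ioc (-(1 / 2)) (1 / 2)).indicator
          (fun η => Complex.exp ((-2 * Real.pi * n * η : ℝ) * Complex.I) * w n) ξ)) := by
  have hcont : ∀ j, Continuous (𝓕 fun y => dilation φ (hε j) y * w y) := fun j =>
    VectorFourier.fourierIntegral_continuous Real.continuous_fourierChar continuous_inner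
      (hw.integrable_mul _)
  have hexp : Continuous fun ξ : ℝ => Complex.exp ((2 * Real.pi * x * ξ : ℝ) * Complex.I) := by
    fun_prop
  have hne : ∀ᵐ ξ : ℝ, |ξ| ≠ 1 / 2 := by
    filter_upwards [measure_eq_zero_iff_ae_notMem.1
      ((Set.toFinite ({1 / 2, -(1 / 2)} : Set ℝ)).measure_zero volume)] with ξ hξ h
    exact hξ (eq_or_eq_neg_of_abs_eq h)
  refine tendsto_integral_filter_of_dominated_convergence ((Set.Icc (-2) 2).indicator fun _ => C)
    (Eventually.of_forall fun j => (hexp.mul (hcont j)).aestronglyMeasurable) ?_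
    ((integrable_indicator_iff measurableSet_Icc).2
      (integrableOn_const isCompact_Icc.measure_lt_top.ne)) ?_
  · filter_upwards [hε₀.eventually_le_const one_pos] with j hj
    refine Eventually.of_forall fun ξ => ?_
    rw [norm_mul, Complex.norm_exp_ofReal_mul_I, one_mul]
    by_cases hξ : ξ ∈ Set.Icc (-2 : ℝ) 2
    · rw [Set.indicator_of_mem hξ]
      exact hC (hε j) ξ
    · rw [Set.indicator_of_notMem hξ, hw.fourier_mul_eq_zero
        (tsupport_fourierInv_dilation_subset (hε j) hφ), norm_zero]
      linarith [not_le.1 (mt abs_le.1 hξ)]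
  · filter_upwards [hne] with ξ hξ
    exact (tendsto_fourier_dilation_mul hw hφ hφ₀ hn hε hε₀ hξ).const_mul _

lemma eq_mul_sinc_of_norm_fourier_le (hw : IsBoundedBandlimited 1 w)
    (hφ : tsupport (𝓕⁻ φ : 𝓢(ℝ, ℂ)) ⊆ Set.Icc (-1) 1) (hφ₀ : φ 0 = 1) (hn : ∀ k ≠ n, w k = 0)
    {C : ℝ} (hC : ∀ {ε : ℝ} (hε : 0 < ε) (ξ : ℝ), ‖𝓕 (fun x => dilation φ hε x * w x) ξ‖ ≤ C)
    (x : ℝ) : w x = w n * Real.sinc (Real.pi * (x - n)) := by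
  have hε : ∀ j : ℕ, 0 < 1 / ((j : ℝ) + 1) := fun j => Nat.one_div_pos_of_nat
  have hε₀ := tendsto_one_div_add_atTop_nhds_zero_nat (𝕜 := ℝ)
  have hleft : Tendsto (fun j => dilation φ (hε j) x * w x) atTop (𝓝 (w x)) := by
    have h := ((φ.continuous.tendsto (0 * x)).comp (hε₀.mul_const x)).mul_const (w x)
    rw [zero_mul, hφ₀, one_mul] at h
    exact h.congr fun j => by rw [dilation_apply]; rfl
  have hlim := tendsto_nhds_unique
    (hleft.congr fun j => hw.mul_eq_integral_fourier
      (tsupport_fourierInv_dilation_subset (hε j) hφ) x)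
    (hw.tendsto_integral_fourier_dilation_mul hφ hφ₀ hn hC hε hε₀ x)
  have hexp : ∀ ξ : ℝ, Complex.exp ((2 * Real.pi * x * ξ : ℝ) * Complex.I) *
      (Set.Ioc (-(1 / 2)) (1 / 2)).indicator
        (fun η => Complex.exp ((-2 * Real.pi * n * η : ℝ) * Complex.I) * w n) ξ =
      (Set.Ioc (-(1 / 2)) (1 / 2)).indicator
        (fun η => Complex.exp ((2 * Real.pi * (x - n) * η : ℝ) * Complex.I) * w n) ξ := fun ξ => by
    simp only [Set.indicator_apply, mul_ite, mul_zero, ← mul_assoc, ← Complex.exp_add]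
    congr 3
    push_cast
    ring
  simp only [hexp] at hlim
  rw [hlim, integral_indicator measurableSet_Ioc, ← intervalIntegral.integral_of_le (by norm_num),
    intervalIntegral.integral_mul_const, integral_exp_eq_sinc, mul_comm]

lemma comp_add_one_add_eq_mul_sinc {g : ℝ → ℂ} (hg : IsBoundedBandlimited 1 g)
    (hn : ∀ k : ℤ, k ≠ n → g (k + 1) + g k = 0) (x : ℝ) :
    g (x + 1) + g x = (g (n + 1) + g n) * Real.sinc (Real.pi * (x - n)) := by
  obtain ⟨φ, hφ, hφ₀⟩ := exists_schwartzMap_tsupport_fourierInv_subset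
  obtain ⟨C, hC⟩ := hg.exists_norm_fourier_dilation_mul_le hφ hn
  exact eq_mul_sinc_of_norm_fourier_le ((hg.comp_add_right 1).add hg) hφ hφ₀ hn hC x

end IsBoundedBandlimited

/-! ### Interpolation of the step samples -/

lemma exists_norm_le_of_comp_add_eq_neg {E : Type*} [SeminormedAddCommGroup E] {d : ℝ → E} {c : ℝ}
    (hd : Continuous d) (hc : c ≠ 0) (h : ∀ x, d (x + c) = -d x) : ∃ M, ∀ x, ‖d x‖ ≤ M := by
  have hper : Function.Periodic (fun x => ‖d x‖) c := fun x => by simp only [h, norm_neg]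
  obtain ⟨M, hM⟩ := (hper.isBounded_of_continuous hc hd.norm).bddAbove
  exact ⟨M, fun x => hM ⟨x, rfl⟩⟩

lemma stepSamples_add_one_add_stepSamples {k : ℤ} (hk : k ≠ -1) :
    stepSamples (k + 1) + stepSamples k = 0 := by
  rw [stepSamples, stepSamples]
  rcases lt_or_ge k 0 with h | h
  · rw [if_pos h, if_pos (by lia), add_zero]
  · rw [if_neg (by lia), if_neg (by lia), zpow_add_one₀ (neg_ne_zero.2 one_ne_zero)]
    ring

lemma IsBoundedBandlimited.not_forall_eq_stepSamples {g : ℝ → ℂ} (hg : IsBoundedBandlimited 1 g) :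
    ¬ ∀ k : ℤ, g k = stepSamples k := by
  intro hk
  have hvanish : ∀ k : ℤ, k ≠ -1 → g (k + 1) + g k = 0 := fun k hk' => by
    rw [← stepSamples_add_one_add_stepSamples hk', ← hk, ← hk, Int.cast_add, Int.cast_one]
  have hjump : g ((-1 : ℤ) + 1) + g (-1 : ℤ) = Real.pi := by
    rw [hk, show ((-1 : ℤ) : ℝ) + 1 = (0 : ℤ) by norm_num, hk]
    simp [stepSamples]
  have hrec : ∀ x, g (x + 1) - G₁ (x + 1 : ℝ) = -(g x - G₁ x) := fun x => by
    have h := hg.comp_add_one_add_eq_mul_sinc hvanish x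
    rw [hjump, Int.cast_neg, Int.cast_one, sub_neg_eq_add] at h
    linear_combination h - G₁_add_one_add_G₁ x
  obtain ⟨M, hM⟩ := hg.exists_norm_le
  obtain ⟨D, hD⟩ := exists_norm_le_of_comp_add_eq_neg
    (hg.continuous.sub continuous_G₁_ofReal) one_ne_zero hrec
  exact not_bounded_G₁_ofReal (M + D) fun x =>
    (norm_le_norm_add_norm_sub (g x) _).trans (add_le_add (hM x) (hD x))

lemma not_exists_mem_paleyWiener_eq_stepSamples :
    ¬ ∃ f ∈ PaleyWiener 1 ⊤, ∃ g : ℝ → ℂ, Continuous g ∧ f =ᵐ[volume] g ∧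
      ∀ k : ℤ, g k = stepSamples k := by
  rintro ⟨f, hf, g, hg, hfg, hk⟩
  exact (IsBoundedBandlimited.of_mem_paleyWiener hf hg hfg).not_forall_eq_stepSamples hk

lemma not_exists_mem_paleyWiener_eq_G₁ :
    ¬ ∃ f ∈ PaleyWiener 1 ⊤, f =ᵐ[volume] fun t : ℝ => G₁ t := by
  rintro ⟨f, hf, hfg⟩
  exact not_exists_mem_paleyWiener_eq_stepSamples ⟨f, hf, _, continuous_G₁_ofReal, hfg, fun k => by
    rw [Complex.ofReal_intCast, G₁_intCast]⟩

end

theorem mainTheorem6 :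
    -- `G₁` is `sin(πz) ψ(-z)` away from the poles of `ψ(-z)`
    (∀ z : ℂ, (∀ n : ℕ, z ≠ n) →
      G₁ z = Complex.sin (Real.pi * z) * Complex.digamma (-z)) ∧
    -- `G₁ ∈ PW_1^+`
    G₁ ∈ PaleyWienerPlus 1 ∧
    -- `G₁ ∉ PW_1^∞`
    (¬ ∃ f ∈ PaleyWiener 1 ⊤, f =ᵐ[volume] fun t : ℝ => G₁ t) ∧
    -- the integer samples of `G₁`
    (∀ k : ℤ, G₁ k = stepSamples k) ∧
    -- with any extra sample, the bandlimited interpolation is `G₁(z) + c sin(πz)`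
    (∀ x : ℝ, (∀ k : ℤ, x ≠ k) → ∀ a' : ℂ, ∃ c : ℂ,
      IsBandlimitedInterp stepSamples x a' fun z => G₁ z + c * Complex.sin (Real.pi * z)) ∧
    -- no element of `PW_1^∞` (through its continuous representative) has these samples
    (¬ ∃ f ∈ PaleyWiener 1 ⊤, ∃ g : ℝ → ℂ, Continuous g ∧ f =ᵐ[volume] g ∧
      ∀ k : ℤ, g k = stepSamples k) ∧
    -- the averages of `|G₁|` grow at least logarithmically, already on the negative half-line
    (∃ C : ℝ, 0 < C ∧ ∀ᶠ r : ℝ in atTop, C * Real.log r ≤ 1 / r * ∫ t in (-r)..0, ‖G₁ t‖) ∧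
    -- the averages over `[-r, r]` are unbounded
    ¬ BddAbove ((fun r : ℝ => 1 / (2 * r) * ∫ t in (-r)..r, ‖G₁ t‖) '' Set.Ioi 0) := by
  exact ⟨fun _ hz => G₁_of_ne_natCast hz, G₁_mem_paleyWienerPlus, not_exists_mem_paleyWiener_eq_G₁,
    G₁_intCast, fun _ hx a' => exists_isBandlimitedInterp_stepSamples hx a',
    not_exists_mem_paleyWiener_eq_stepSamples, exists_mul_log_le_average_norm_G₁,
    not_bddAbove_average_norm_G₁⟩
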